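/- **Theorem 1 (Asymptotic consistency of OCBA-MCTS).** *Decision process.* Let $X$ and $A$ be finite sets of states and actions, $H$ a horizon, and $A_x\subseteq A$ the nonempty set of actions available in state $x$. Taking action $a\in A_x$ in state $x$ at stage $t<H$ produces a random pair consisting of a reward $R_t(x,a)$ and a next state $y\sim P_t(x,a)$ (reward and next state may be dependent); outcomes at different stages are independent given the states and actions. Let $V^*_t(x)=\max_\pi \mathbb E\big[\sum_{s=t}^{H-1}R_s(x_s,\pi_s(x_s))\,\big|\,x_t=x\big]$, the maximum being over nonstationary Markovian policies, so that $V^*_H=0$. For $t<H$ let $Q_t(x,a)=\mathbb E[R_t(x,a)]+\sum_y P_t(x,a)(y)V^*_{t+1}(y)$, and let $\hat Q_t(x,a)=R_t(x,a)+V^*_{t+1}(y)$ be the random cumulative reward. A state node is a pair $\mathbf x=(x,t)$ with $0\le t\le H$, and it is terminal if $t=H$; we write $V^*(\mathbf x)$, $Q(\mathbf x,a)$, $\hat Q(\mathbf x,a)$, $A_{\mathbf x}=A_x$. *Statistical model.* The environment (the laws of all rewards and transitions) is drawn once from a prior. Given the environment, $\hat Q(\mathbf x,a)\sim N(\mu(\mathbf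 x,a),\sigma^2(\mathbf x,a))$ for every nonterminal $\mathbf x$ and $a\in A_{\mathbf x}$, with known variances $0<\sigma^2(\mathbf x,a)<\infty$. Under the prior, $\mu(\mathbf x,a)\sim N(m(\mathbf x,a),\tau^2(\mathbf x,a))$ with arbitrary unknown mean $m(\mathbf x,a)$, and $\mu(\mathbf x,a)$, $\mu(\mathbf x,b)$ are independent for distinct $a,b\in A_{\mathbf x}$. The case $\tau^2=0$ (a fixed mean) is allowed, except that at a nonterminal node with at least three available actions, two distinct actions $a,b$ with $\tau^2(\mathbf x,a)=\tau^2(\mathbf x,b)=0$ must have $m(\mathbf x,a)\ne m(\mathbf x,b)$. Below, $V^*$, $Q$, and $\mathbb E[\hat Q(\mathbf x,a)]$ are those of the realized environment. *Algorithm.* Fix a root $\mathbf x_0=(x_0,0)$, an integer $n_0>1$, and smoothing parameters $\alpha_n\in[0,1]$ with $\alpha_n\to1$. All counts $N(\mathbf x),N(\mathbf x,a)$ and values $\bar Q(\mathbf x,a),\bar V(\mathbf x),\hat V(\mathbf x)$ start at $0$. The algorithm performs $N$ rollouts. Each rollout first generates a path from $\mathbf x_0$. At a nonterminal state node $\mathbf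 x$ on the path, if some $a\in A_{\mathbf x}$ has $N(\mathbf x,a)<n_0$, a random such action is taken, and the path ends at the sampled next state node (the leaf). Otherwise an action is chosen by OCBA and the path continues from the sampled next state node. The path also ends (and its last node is the leaf) when a terminal node is reached. *OCBA selection* at $\mathbf x$: let $b$ maximize $\bar Q(\mathbf x,\cdot)$ on $A_{\mathbf x}$ and let $\delta(a)=\bar Q(\mathbf x,b)-\bar Q(\mathbf x,a)$. Let $(\tilde N(a))_{a\in A_{\mathbf x}}$ be the nonnegative solution of $$\frac{\tilde N(a')}{\tilde N(a)}=\Big(\frac{\sigma(\mathbf x,a')/\delta(a')}{\sigma(\mathbf x,a)/\delta(a)}\Big)^2\ (a,a'\ne b),\qquad \tilde N(b)=\sigma(\mathbf x,b)\sqrt{\sum_{a\ne b}\frac{\tilde N(a)^2}{\sigma^2(\mathbf x,a)}},\qquad \sum_{a}\tilde N(a)=\sum_{a}N(\mathbf x,a)+1,$$ and take an action that maximizes $\tilde N(a)-N(\mathbf x,a)$; if $|A_{\mathbf x}|=1$, take the only action. (Ties in sample means, for which the equations degenerate, have probability zero.) The counts of all state nodes and state-action nodes on the path, including the leaf, are increased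 by one. Then a path from the leaf to a terminal node is simulated with randomly chosen actions; let $r$ be its total reward. At the leaf $\mathbf x_l$, set $\hat V(\mathbf x_l)\leftarrow\frac{N(\mathbf x_l)-1}{N(\mathbf x_l)}\hat V(\mathbf x_l)+\frac1{N(\mathbf x_l)}r$. Then, backwards along the path, for each state node $\mathbf x$ with action $a$, observed reward $R$ and next state node $\mathbf y$, set $$\bar Q(\mathbf x,a)\leftarrow\tfrac{N(\mathbf x,a)-1}{N(\mathbf x,a)}\bar Q(\mathbf x,a)+\tfrac{1}{N(\mathbf x,a)}\big(R+\hat V(\mathbf y)\big),\qquad \bar V(\mathbf x)\leftarrow\tfrac{N(\mathbf x)-1}{N(\mathbf x)}\bar V(\mathbf x)+\tfrac1{N(\mathbf x)}\bar Q(\mathbf x,a),$$ $$\hat V(\mathbf x)\leftarrow(1-\alpha_{N(\mathbf x)})\bar V(\mathbf x)+\alpha_{N(\mathbf x)}\max_{a'\in A_{\mathbf x}}\bar Q(\mathbf x,a').$$ Outcomes of actions are sampled independently over rollouts and stages from the realized environment. Random choices of actions and tie-breaking may follow any fixed randomized rule (for instance uniform), drawn independently over rollouts and stages and independently of the outcomes.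 *Conclusion.* For almost every realization of the environment, with probability one: for every state node $\mathbf x$ reachable from $\mathbf x_0$ (by available actions and transitions of positive probability), $$\lim_{N\to\infty}\bar Q(\mathbf x,a)=\mathbb E[\hat Q(\mathbf x,a)]=Q(\mathbf x,a)\quad\text{for all }a\in A_{\mathbf x},\text{ if }\mathbf x\text{ is nonterminal},\qquad \lim_{N\to\infty}\hat V(\mathbf x)=V^*(\mathbf x).$$ -/

import Mathlib

open MeasureTheory ProbabilityTheory Filter Topology
open scoped NNReal

noncomputable section

namespace OCBAMCTS

/-! ### The finite-horizon Markov decision process -/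

/-- The combinatorial data of the search tree: the horizon `H` and the nonempty finite set `A_x` of
actions available in each state `x`. A state node is a pair (stage `t ≤ H`, state `x`); it is
terminal exactly when `t = H`. -/
structure Model (X A : Type*) where
  horizon : ℕ
  avail : X → Finset A
  avail_nonempty : ∀ x, (avail x).Nonempty

/-- The stochastic dynamics: `law t x a` is the joint law of the pair (reward `R_t(x, a)`, next
state) when action `a` is taken in state `x` at stage `t`. Its second marginal is `P_t(x, a)`. -/
structure Dynamics (X A : Type*) [MeasurableSpace X] where
  law : ℕ → X → A → Measure (ℝ × X)
  prob : ∀ t x a, IsProbabilityMeasure (law t x a)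

attribute [instance] Dynamics.prob

section MDP

variable {X A : Type*} [Fintype X] [MeasurableSpace X] [Fintype A]

/-- `P_t(x, a)(y)`. -/
def Dynamics.trans (D : Dynamics X A) (t : ℕ) (x : X) (a : A) (y : X) : ℝ :=
  (D.law t x a).real (Prod.snd ⁻¹' {y})

/-- Law of one family of independent outcomes (reward, next state), one for each state and action,
at stage `t`. Along one trajectory, at most one entry per stage is ever looked at. -/
def Dynamics.stageLaw (D : Dynamics X A) (t : ℕ) : Measure (X → A → ℝ × X) :=
  Measure.pi fun x => Measure.pi fun a => D.law t x a

instance (D : Dynamics X A) (t : ℕ) : IsProbabilityMeasure (D.stageLaw t) := by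
  unfold Dynamics.stageLaw; infer_instance

/-- Nonstationary Markovian policies. -/
def Policy (G : Model X A) : Type _ := {p : ℕ → X → A // ∀ t x, p t x ∈ G.avail x}

/-- Total reward collected in the `k` stages `t, …, t + k - 1` by following `p` from state `x` at
stage `t`, when the outcomes of the actions are read off from `w`. -/
def policyReturn (p : ℕ → X → A) (w : ℕ → X → A → ℝ × X) : ℕ → ℕ → X → ℝ
  | 0, _, _ => 0
  | k + 1, t, x => (w t x (p t x)).1 + policyReturn p w k (t + 1) (w t x (p t x)).2

/-- Expected total reward of the policy `p` from state `x` at stage `t` up to the horizon. -/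
def policyValue (G : Model X A) (D : Dynamics X A) (p : Policy G) (t : ℕ) (x : X) : ℝ :=
  ∫ w, policyReturn p.1 w (G.horizon - t) t x ∂(Measure.infinitePi D.stageLaw)

/-- Optimal reward-to-go `V*_t(x)`. -/
def Vstar (G : Model X A) (D : Dynamics X A) (t : ℕ) (x : X) : ℝ :=
  ⨆ p : Policy G, policyValue G D p t x

/-- `Q_t(x, a) = E[R_t(x, a)] + ∑_y P_t(x, a)(y) V*_{t+1}(y)`, for `t < H`. -/
def Qstar (G : Model X A) (D : Dynamics X A) (t : ℕ) (x : X) (a : A) : ℝ :=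
  ∫ z, z.1 ∂(D.law t x a) + ∑ y, D.trans t x a y * Vstar G D (t + 1) y

/-- The random cumulative reward `Q̂(x, a) = R(x, a) + V*(y)`, as a function of the outcome
`z = (R, y)` of taking action `a` in state `x` at stage `t`. -/
def cumReward (G : Model X A) (D : Dynamics X A) (t : ℕ) (z : ℝ × X) : ℝ :=
  z.1 + Vstar G D (t + 1) z.2

/-- State nodes that can be reached from the root `(0, x₀)`. -/
inductive Reachable (G : Model X A) (D : Dynamics X A) (x₀ : X) : ℕ → X → Prop
  | root : Reachable G D x₀ 0 x₀
  | step {t : ℕ} {x : X} {a : A} {y : X} : Reachable G D x₀ t x → t < G.horizon →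
      a ∈ G.avail x → 0 < D.trans t x a y → Reachable G D x₀ (t + 1) y

end MDP

/-! ### The OCBA allocation -/

section Allocation

variable {A : Type*} [DecidableEq A]

/-- The equations that define the OCBA allocation `Nt` of a total budget `T` over the actions in
`S`, where `b` is the sample-best action, `σ` the standard deviations and `δ` the differences
between the sample mean of `b` and the other sample means. -/
def IsAllocation (S : Finset A) (σ δ : A → ℝ) (b : A) (T : ℝ) (Nt : A → ℝ) : Prop :=
  (∀ a ∈ S, 0 ≤ Nt a) ∧
  (∀ a ∈ S.erase b, ∀ a' ∈ S.erase b,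
    Nt a' / Nt a = ((σ a' / δ a') / (σ a / δ a)) ^ 2) ∧
  Nt b = σ b * √(∑ a ∈ S.erase b, Nt a ^ 2 / σ a ^ 2) ∧
  ∑ a ∈ S, Nt a = T

/-- Unnormalised OCBA allocation. -/
def allocWeight (S : Finset A) (σ δ : A → ℝ) (b a : A) : ℝ :=
  if a = b then σ b * √(∑ c ∈ S.erase b, ((σ c / δ c) ^ 2) ^ 2 / σ c ^ 2) else (σ a / δ a) ^ 2

/-- The OCBA allocation in closed form; see `isAllocation_iff`. -/
def allocation (S : Finset A) (σ δ : A → ℝ) (b : A) (T : ℝ) (a : A) : ℝ :=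
  T * allocWeight S σ δ b a / ∑ c ∈ S, allocWeight S σ δ b c

/-- If there are at least two actions and no other action ties with the sample-best one, then
`allocation` is the unique solution of the OCBA equations. -/
theorem isAllocation_iff (S : Finset A) (σ δ : A → ℝ) (b : A) (T : ℝ) (Nt : A → ℝ)
    (hb : b ∈ S) (hS : (S.erase b).Nonempty) (hσ : ∀ a ∈ S, 0 < σ a)
    (hδ : ∀ a ∈ S.erase b, 0 < δ a) (hT : 0 < T) :
    IsAllocation S σ δ b T Nt ↔ ∀ a ∈ S, Nt a = allocation S σ δ b T a := by
  have hw : ∀ a ∈ S.erase b, 0 < (σ a / δ a) ^ 2 := fun a ha =>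
    pow_pos (div_pos (hσ a (Finset.mem_of_mem_erase ha)) (hδ a ha)) 2
  set r : A → ℝ := fun a => (σ a / δ a) ^ 2 with hr
  set B : ℝ := σ b * √(∑ c ∈ S.erase b, r c ^ 2 / σ c ^ 2) with hB
  have hB0 : 0 ≤ B := mul_nonneg (hσ b hb).le (Real.sqrt_nonneg _)
  have hwb : allocWeight S σ δ b b = B := by simp [allocWeight, hB, hr]
  have hwa : ∀ a ∈ S.erase b, allocWeight S σ δ b a = r a := fun a ha => by
    simp [allocWeight, Finset.ne_of_mem_erase ha, hr]
  have hsum : ∑ c ∈ S, allocWeight S σ δ b c = B + ∑ c ∈ S.erase b, r c := by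
    rw [← Finset.add_sum_erase S _ hb, hwb, Finset.sum_congr rfl hwa]
  have hR : 0 < ∑ c ∈ S.erase b, r c := Finset.sum_pos hw hS
  have hZ : 0 < B + ∑ c ∈ S.erase b, r c := by linarith
  have key : ∀ k : ℝ, 0 ≤ k →
      σ b * √(∑ a ∈ S.erase b, (k * r a) ^ 2 / σ a ^ 2) = k * B := fun k hk => by
    have : ∑ a ∈ S.erase b, (k * r a) ^ 2 / σ a ^ 2
        = k ^ 2 * ∑ a ∈ S.erase b, r a ^ 2 / σ a ^ 2 := by
      rw [Finset.mul_sum]; exact Finset.sum_congr rfl fun a _ => by ring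
    rw [this, Real.sqrt_mul (sq_nonneg k), Real.sqrt_sq hk, hB]; ring
  constructor
  · rintro ⟨h0, h1, h2, h3⟩
    obtain ⟨c, hc⟩ := hS
    have hc' := hw c hc
    have hne : ∀ a ∈ S.erase b, Nt a ≠ 0 := fun a ha h => by
      have := h1 a ha a ha
      have hpos := (div_pos (hσ a (Finset.mem_of_mem_erase ha)) (hδ a ha)).ne'
      rw [h, div_self hpos] at this
      norm_num at this
    have hNt : ∀ a ∈ S.erase b, Nt a = (Nt c / r c) * r a := fun a ha => by
      have h := h1 c hc a ha
      rw [div_pow, div_eq_iff (hne c hc)] at h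
      rw [h]; simp only [hr]; ring
    have hk : 0 ≤ Nt c / r c := div_nonneg (h0 c (Finset.mem_of_mem_erase hc)) hc'.le
    have hNb : Nt b = (Nt c / r c) * B := by
      rw [h2, ← key _ hk]
      congr 2
      exact Finset.sum_congr rfl fun a ha => by rw [hNt a ha]
    have hkT : (Nt c / r c) * (B + ∑ a ∈ S.erase b, r a) = T := by
      rw [← h3, ← Finset.add_sum_erase S _ hb, hNb, Finset.sum_congr rfl hNt, ← Finset.mul_sum]
      ring
    have hkk : Nt c / r c = T / (B + ∑ a ∈ S.erase b, r a) := by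
      rw [eq_div_iff hZ.ne', hkT]
    intro a ha
    by_cases hab : a = b
    · subst hab
      rw [hNb, hkk, allocation, hsum, hwb]; ring
    · have ha' := Finset.mem_erase.2 ⟨hab, ha⟩
      rw [hNt a ha', hkk, allocation, hsum, hwa a ha']; ring
  · intro h
    set k : ℝ := T / (B + ∑ a ∈ S.erase b, r a) with hk
    have hk0 : 0 < k := div_pos hT hZ
    have hNb : Nt b = k * B := by rw [h b hb, allocation, hsum, hwb, hk]; ring
    have hNa : ∀ a ∈ S.erase b, Nt a = k * r a := fun a ha => by
      rw [h a (Finset.mem_of_mem_erase ha), allocation, hsum, hwa a ha, hk]; ring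
    refine ⟨fun a ha => ?_, fun a ha a' ha' => ?_, ?_, ?_⟩
    · by_cases hab : a = b
      · subst hab; rw [hNb]; positivity
      · have ha' := Finset.mem_erase.2 ⟨hab, ha⟩
        rw [hNa a ha']; exact mul_nonneg hk0.le (hw a ha').le
    · rw [hNa a ha, hNa a' ha', mul_div_mul_left _ _ hk0.ne', div_pow]
    · rw [hNb, ← key k hk0.le]
      congr 2
      exact Finset.sum_congr rfl fun a ha => by rw [hNa a ha]
    · rw [← Finset.add_sum_erase S _ hb, hNb, Finset.sum_congr rfl hNa, ← Finset.mul_sum, ← mul_add,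
        hk, div_mul_cancel₀ _ hZ.ne']

end Allocation

/-! ### The algorithm -/

section Algorithm

variable {X A : Type*} [DecidableEq X] [DecidableEq A]

/-- A rule that picks an element of each nonempty finite set of actions. The random choices of the
algorithm are made with a random rule. -/
def ChoiceRule (A : Type*) : Type _ := {c : Finset A → A // ∀ S, S.Nonempty → c S ∈ S}

instance : MeasurableSpace (ChoiceRule A) := ⊤

/-- What is drawn afresh in each rollout at each stage: the outcome (reward, next state) of every
action in every state, and a rule for making choices. -/
abbrev Noise (X A : Type*) : Type _ := (X → A → ℝ × X) × ChoiceRule A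

/-- The parameters of the algorithm: the known standard deviations `σ(x, a)` of the cumulative
rewards, the number `n₀` of times each state-action node is expanded before the OCBA policy is used,
and the smoothing parameters `α_n`. -/
structure Params (X A : Type*) where
  sd : ℕ → X → A → ℝ≥0
  n₀ : ℕ
  α : ℕ → ℝ

/-- The statistics kept by the algorithm: `N(x)`, `N(x, a)`, `Q̄(x, a)`, `V̄(x)` and `V̂(x)` for each
state node `(t, x)`. -/
structure Stats (X A : Type*) where
  N : ℕ → X → ℕ
  NA : ℕ → X → A → ℕ
  Qbar : ℕ → X → A → ℝ
  Vbar : ℕ → X → ℝ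
  Vhat : ℕ → X → ℝ

def Stats.init : Stats X A := ⟨fun _ _ => 0, fun _ _ _ => 0, fun _ _ _ => 0, fun _ _ => 0,
  fun _ _ => 0⟩

/-- The maximisers of `f` on `S`. -/
def argmaxOn (S : Finset A) (f : A → ℝ) : Finset A := S.filter fun a => ∀ b ∈ S, f b ≤ f a

/-- OCBA selection at the state node `(t, x)`: find the sample-best action, compute the allocation
of a budget of one more than the present number of samples, and return the most starving action.
Ties in an argmax are broken by `c`. -/
def ocbaSelect (G : Model X A) (P : Params X A) (s : Stats X A) (c : ChoiceRule A) (t : ℕ) (x : X) :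
    A :=
  let S := G.avail x
  let b := c.1 (argmaxOn S (s.Qbar t x))
  let δ : A → ℝ := fun a => s.Qbar t x b - s.Qbar t x a
  let T : ℝ := ∑ a ∈ S, (s.NA t x a : ℝ) + 1
  c.1 (argmaxOn S fun a => allocation S (fun a' => (P.sd t x a' : ℝ)) δ b T a - s.NA t x a)

/-- The available actions at `(t, x)` that have been sampled fewer than `n₀` times. The node is
expandable if there is one. -/
def unexpanded (G : Model X A) (P : Params X A) (s : Stats X A) (t : ℕ) (x : X) : Finset A :=
  (G.avail x).filter fun a => s.NA t x a < P.n₀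

/-- One state-action node of a path: at stage `t` in state `x`, action `a` was taken, giving the
reward `r` and leading to the state `y` at stage `t + 1`. -/
structure PathStep (X A : Type*) where
  t : ℕ
  x : X
  a : A
  r : ℝ
  y : X

/-- Selection phase, from the node `(t, x)` with `k` stages to go. It returns the state-action nodes
of the path in order, and the state node at which the path ends. -/
def selection (G : Model X A) (P : Params X A) (s : Stats X A) (w : ℕ → Noise X A) :
    ℕ → ℕ → X → List (PathStep X A) × (ℕ × X)
  | 0, t, x => ([], (t, x))
  | k + 1, t, x =>
    if (unexpanded G P s t x).Nonempty then
      let a := (w t).2.1 (unexpanded G P s t x)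
      let z := (w t).1 x a
      ([⟨t, x, a, z.1, z.2⟩], (t + 1, z.2))
    else
      let a := ocbaSelect G P s (w t).2 t x
      let z := (w t).1 x a
      let p := selection G P s w k (t + 1) z.2
      (⟨t, x, a, z.1, z.2⟩ :: p.1, p.2)

/-- Simulation phase, from the node `(t, x)` with `k` stages to go: the total reward of a path to a
terminal node along which actions are chosen at random. -/
def simulate (G : Model X A) (w : ℕ → Noise X A) : ℕ → ℕ → X → ℝ
  | 0, _, _ => 0
  | k + 1, t, x =>
    let z := (w t).1 x ((w t).2.1 (G.avail x))
    z.1 + simulate G w k (t + 1) z.2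

/-- Replace the value of `f` at `(t, x)` by `v`. -/
def setAt {β : Type*} (f : ℕ → X → β) (t : ℕ) (x : X) (v : β) : ℕ → X → β :=
  Function.update f t (Function.update (f t) x v)

/-- Update at the final node `(t, x)` of a path, where `r` is the simulated reward. -/
def leafUpdate (s : Stats X A) (t : ℕ) (x : X) (r : ℝ) : Stats X A :=
  let n := s.N t x + 1
  { s with
    N := setAt s.N t x n
    Vhat := setAt s.Vhat t x (((n : ℝ) - 1) / n * s.Vhat t x + 1 / n * r) }

/-- Update at a state node of a path and the state-action node that follows it on the path. A path
visits each stage at most once, so that the visit counts, which are increased when the path is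
selected, may equivalently be increased here. -/
def nodeUpdate (G : Model X A) (P : Params X A) (e : PathStep X A) (s : Stats X A) : Stats X A :=
  let n := s.N e.t e.x + 1
  let m := s.NA e.t e.x e.a + 1
  let qhat := e.r + s.Vhat (e.t + 1) e.y
  let qbar := ((m : ℝ) - 1) / m * s.Qbar e.t e.x e.a + 1 / m * qhat
  let row := Function.update (s.Qbar e.t e.x) e.a qbar
  let vbar := ((n : ℝ) - 1) / n * s.Vbar e.t e.x + 1 / n * qbar
  let vhat := (1 - P.α n) * vbar + P.α n * (G.avail e.x).sup' (G.avail_nonempty e.x) row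
  { N := setAt s.N e.t e.x n
    NA := setAt s.NA e.t e.x (Function.update (s.NA e.t e.x) e.a m)
    Qbar := setAt s.Qbar e.t e.x row
    Vbar := setAt s.Vbar e.t e.x vbar
    Vhat := setAt s.Vhat e.t e.x vhat }

/-- One rollout from the root: selection with expansion, simulation, and backpropagation from the
end of the path to the root. -/
def rollout (G : Model X A) (P : Params X A) (x₀ : X) (s : Stats X A) (w : ℕ → Noise X A) :
    Stats X A :=
  let p := selection G P s w G.horizon 0 x₀
  let r := simulate G w (G.horizon - p.2.1) p.2.1 p.2.2
  p.1.foldr (nodeUpdate G P) (leafUpdate s p.2.1 p.2.2 r)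

/-- The statistics after `n` rollouts from the root, where `ω i` is the noise of rollout `i`. -/
def run (G : Model X A) (P : Params X A) (x₀ : X) (ω : ℕ → ℕ → Noise X A) : ℕ → Stats X A
  | 0 => Stats.init
  | n + 1 => rollout G P x₀ (run G P x₀ ω n) (ω n)

/-- The law of the noise of all rollouts: independent over rollouts and stages. Outcomes follow the
dynamics of the decision process and choices are made with random rules of law `ν`. -/
def runLaw [Fintype X] [MeasurableSpace X] [Fintype A] (D : Dynamics X A)
    (ν : Measure (ChoiceRule A)) [IsProbabilityMeasure ν] : Measure (ℕ → ℕ → Noise X A) :=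
  Measure.infinitePi fun _ : ℕ => Measure.infinitePi fun t : ℕ => (D.stageLaw t).prod ν

end Algorithm

end OCBAMCTS

end

set_option linter.unusedSectionVars false

noncomputable section

namespace OCBAMCTS

/-! ### Redrawing one coordinate of a product measure -/

section Resampling

/-! The prior enters only to exclude ties: almost surely the means of distinct actions differ at
every node with at least three actions. In such a fixed environment, convergence is proved by
backward induction on the stage, for the nodes visited infinitely often.

Suppose the value estimates of recurring successors converge. For an action taken infinitely often,
`Qbar` is the average of `R + Vhat(y)`. Replacing `Vhat(y)` by `Vstar(y)` changes the average by a
vanishing amount, and the remaining average of normal cumulative rewards obeys a law of large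
numbers for adaptive sampling (`ae_tendsto_average_of_resampling`, `tendsto_Qbar_run`). That law
holds because the decision to sample ignores the outcome about to be seen: the outcome can be
redrawn without changing the decision or the past, so the centred sums weighted by 1/(number of
samples) form an L²-bounded martingale, and Kronecker's lemma applies.

The crux is that OCBA starves no action (`forall_frequently_of_ocba`). Let `I` be the set of actions
taken infinitely often, and suppose that some action is not in it. Means of actions in `I` converge,
the others freeze. Outcomes have no atoms, so a frozen mean never equals a true mean (`ae_Qbar_ne`);
together with the absence of ties, the limit of each action in `I` differs from all other limits.
The OCBA shares of `I` are then eventually bounded by numbers with sum less than one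
(`exists_share_of_tendsto`). But an action is chosen only if its deficit is at least that of the
starved one, so each count in `I` exceeds its allotment by at most a constant. Hence `I` cannot
absorb the whole budget, a contradiction (`false_of_allocation_le`). With two actions the gap
cancels from the allocation, so ties are harmless there.

Once every action recurs, all `Qbar` converge. `Vbar` is bounded and `α` tends to one, so `Vhat`
follows the maximum of `Qbar`, which is `Vstar` by Bellman's equation (`tendsto_Vhat_run`,
`Vstar_eq_sup'_Qstar`). Finally, transitions of positive probability occur infinitely often, so
every reachable node recurs. -/

theorem measurePreserving_update_infinitePi {ι : Type*} [DecidableEq ι] {E : ι → Type*}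
    [∀ i, MeasurableSpace (E i)] (μ : ∀ i, Measure (E i)) [∀ i, IsProbabilityMeasure (μ i)]
    {Z : Type*} [MeasurableSpace Z] (κ : Measure Z) [IsProbabilityMeasure κ] (i : ι)
    (U : E i → Z → E i)
    (hU : MeasurePreserving (fun p : E i × Z => U p.1 p.2) ((μ i).prod κ) (μ i)) :
    MeasurePreserving (fun p : (∀ j, E j) × Z => Function.update p.1 i (U (p.1 i) p.2))
      ((Measure.infinitePi μ).prod κ) (Measure.infinitePi μ) := by
  have hm : Measurable (fun p : (∀ j, E j) × Z => Function.update p.1 i (U (p.1 i) p.2)) := by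
    refine measurable_pi_lambda _ fun j => ?_
    by_cases h : j = i
    · subst h
      simp only [Function.update_self]
      exact hU.measurable.comp (f := fun p : (∀ j, E j) × Z => (p.1 j, p.2)) (by fun_prop)
    · simp only [Function.update_of_ne h]
      fun_prop
  -- Boxes determine the product measure. For fixed `z` the preimage of a box is a box in which only
  -- the side at `i` has changed, and integrating over `z` restores its measure. Since `U` may read
  -- the old coordinate, the result can be iterated through nested products.
  refine ⟨hm, Measure.eq_infinitePi _ fun s B hB => ?_⟩
  rw [Measure.map_apply hm (MeasurableSet.pi s.countable_toSet fun j _ => hB j)]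
  have hBi := hU.measurable (hB i)
  by_cases hi : i ∈ s
  · set V : Z → Set (E i) := fun z => (fun e => U e z) ⁻¹' B i with hV
    have hVm : ∀ z, MeasurableSet (V z) := fun z =>
      (hU.measurable.comp (f := fun e : E i => (e, z)) (by fun_prop)) (hB i)
    rw [Measure.prod_apply_symm (hm (MeasurableSet.pi s.countable_toSet fun j _ => hB j))]
    have : ∀ z, (Measure.infinitePi μ) ((fun x => (x, z)) ⁻¹'
        ((fun p : (∀ j, E j) × Z => Function.update p.1 i (U (p.1 i) p.2)) ⁻¹'
          (Set.pi (s : Set ι) B))) = μ i (V z) * ∏ j ∈ s.erase i, μ j (B j) := fun z => by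
      have : ((fun x => (x, z)) ⁻¹'
        ((fun p : (∀ j, E j) × Z => Function.update p.1 i (U (p.1 i) p.2)) ⁻¹'
          (Set.pi (s : Set ι) B))) = Set.pi (s : Set ι) (Function.update B i (V z)) := by
        ext ω
        simp only [Set.mem_preimage, Set.mem_pi, Finset.mem_coe]
        refine forall₂_congr fun j hj => ?_
        by_cases h : j = i
        · subst h; simp [hV]
        · simp [Function.update_of_ne h]
      rw [this, Measure.infinitePi_pi _ fun j _ => ?_]
      · rw [← Finset.mul_prod_erase s _ hi]
        congr 1
        · simp
        · exact Finset.prod_congr rfl fun j hj => by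
            rw [Function.update_of_ne (Finset.ne_of_mem_erase hj)]
      · by_cases h : j = i
        · subst h; simpa using hVm z
        · simpa [Function.update_of_ne h] using hB j
    simp_rw [this]
    rw [lintegral_mul_const'', ← Finset.mul_prod_erase s _ hi]
    · congr 1
      rw [← hU.measure_preimage (hB i).nullMeasurableSet, Measure.prod_apply_symm hBi]
      rfl
    · have := measurable_measure_prodMk_right (μ := μ i) hBi
      exact this.aemeasurable
  · have : ((fun p : (∀ j, E j) × Z => Function.update p.1 i (U (p.1 i) p.2)) ⁻¹'
        (Set.pi (s : Set ι) B)) = Set.pi (s : Set ι) B ×ˢ Set.univ := by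
      ext ⟨ω, z⟩
      simp only [Set.mem_preimage, Set.mem_pi, Finset.mem_coe, Set.mem_prod, Set.mem_univ, and_true]
      refine forall₂_congr fun j hj => ?_
      rw [Function.update_of_ne (fun h => hi (by rwa [← h]))]
    rw [this, Measure.prod_prod, measure_univ, mul_one, Measure.infinitePi_pi _ fun j _ => hB j]

theorem measurePreserving_update_pi {ι : Type*} [DecidableEq ι] [Fintype ι] {E : ι → Type*}
    [∀ i, MeasurableSpace (E i)] (μ : ∀ i, Measure (E i)) [∀ i, IsProbabilityMeasure (μ i)]
    {Z : Type*} [MeasurableSpace Z] (κ : Measure Z) [IsProbabilityMeasure κ] (i : ι)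
    (U : E i → Z → E i)
    (hU : MeasurePreserving (fun p : E i × Z => U p.1 p.2) ((μ i).prod κ) (μ i)) :
    MeasurePreserving (fun p : (∀ j, E j) × Z => Function.update p.1 i (U (p.1 i) p.2))
      ((Measure.pi μ).prod κ) (Measure.pi μ) := by
  rw [← Measure.infinitePi_eq_pi]
  exact measurePreserving_update_infinitePi μ κ i U hU

/-- A way to redraw the coordinate `π` of a random point, of law `κ`, without changing the law of
the point. -/
structure Resampling {Ω Z : Type*} [MeasurableSpace Ω] [MeasurableSpace Z] (P : Measure Ω)
    (κ : Measure Z) (π : Ω → Z) (upd : Ω → Z → Ω) : Prop where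
  preserving : MeasurePreserving (fun p : Ω × Z => upd p.1 p.2) (P.prod κ) P
  coord : ∀ ω z, π (upd ω z) = z
  measurable : Measurable π

variable {Ω Z : Type*} [MeasurableSpace Ω] [MeasurableSpace Z] {P : Measure Ω}
    [IsProbabilityMeasure P] {κ : Measure Z} [IsProbabilityMeasure κ] {π : Ω → Z}
    {upd : Ω → Z → Ω}

theorem Resampling.measurePreserving_coord (h : Resampling P κ π upd) :
    MeasurePreserving π P κ := by
  refine ⟨h.measurable, ?_⟩
  conv_lhs => rw [← h.preserving.map_eq]
  rw [Measure.map_map h.measurable h.preserving.measurable]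
  have : π ∘ (fun p : Ω × Z => upd p.1 p.2) = Prod.snd := by ext p; exact h.coord _ _
  rw [this, measurePreserving_snd.map_eq]

/-- Independence in the form used throughout: after redrawing, `g` sees only the old point and `φ`
only the new coordinate, so Fubini factors the integral. -/
theorem Resampling.integral_mul (h : Resampling P κ π upd) {g : Ω → ℝ} {φ : Z → ℝ}
    (hg : Measurable g) (hφ : Measurable φ) (hinv : ∀ ω z, g (upd ω z) = g ω) :
    ∫ ω, g ω * φ (π ω) ∂P = (∫ ω, g ω ∂P) * ∫ z, φ z ∂κ := by
  have hm : Measurable fun ω => g ω * φ (π ω) := hg.mul (hφ.comp h.measurable)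
  conv_lhs => rw [← h.preserving.map_eq]
  rw [integral_map h.preserving.measurable.aemeasurable hm.aestronglyMeasurable]
  simp_rw [hinv, h.coord]
  exact integral_prod_mul g φ

theorem Resampling.integrable_mul (h : Resampling P κ π upd) {g : Ω → ℝ} {φ : Z → ℝ}
    (hg : Integrable g P) (hφ : Integrable φ κ) (hgm : Measurable g) (hφm : Measurable φ)
    (hinv : ∀ ω z, g (upd ω z) = g ω) :
    Integrable (fun ω => g ω * φ (π ω)) P := by
  have hm : Measurable fun ω => g ω * φ (π ω) := hgm.mul (hφm.comp h.measurable)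
  rw [← h.preserving.map_eq,
    integrable_map_measure hm.aestronglyMeasurable h.preserving.measurable.aemeasurable]
  have : ((fun ω => g ω * φ (π ω)) ∘ fun p : Ω × Z => upd p.1 p.2) = fun p => g p.1 * φ p.2 := by
    ext p; simp [hinv, h.coord]
  rw [this]
  exact hg.mul_prod hφ

/-- By Fubini, an event may be tested for nullity with everything but the redrawn coordinate frozen.
-/
theorem Resampling.measure_eq_zero (h : Resampling P κ π upd) {E : Set Ω} (hE : MeasurableSet E)
    (hz : ∀ ω, κ {z | upd ω z ∈ E} = 0) : P E = 0 := by
  rw [← h.preserving.measure_preimage hE.nullMeasurableSet,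
    Measure.measure_prod_null (h.preserving.measurable hE)]
  exact Eventually.of_forall hz

end Resampling

/-! ### Strong law of large numbers under adaptive sampling -/

section AdaptiveLLN

/-- Cesàro averages along a set of indices with indicator `c`. -/
theorem tendsto_weighted_average_zero {c y : ℕ → ℝ} (hc0 : ∀ i, 0 ≤ c i)
    (hK : Tendsto (fun n => ∑ i ∈ Finset.range n, c i) atTop atTop)
    (hy : ∀ ε > 0, ∀ᶠ i in atTop, c i ≠ 0 → |y i| ≤ ε) :
    Tendsto (fun n => (∑ i ∈ Finset.range n, c i * y i) / ∑ i ∈ Finset.range n, c i) atTop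
      (𝓝 0) := by
  have h : (fun i => c i * y i) =o[atTop] c := by
    refine Asymptotics.isLittleO_iff.2 fun ε hε => ?_
    filter_upwards [hy ε hε] with i hi
    by_cases h : c i = 0
    · simp [h]
    · rw [norm_mul, mul_comm]
      exact mul_le_mul_of_nonneg_right (by simpa using hi h) (norm_nonneg _)
  exact (h.sum_range hc0 hK).tendsto_div_nhds_zero

/-- Kronecker's lemma along the sampling times. Summation by parts writes the average as `S n - s`
minus a Cesàro mean of the same quantity, and both vanish. -/
theorem tendsto_average_zero_of_tendsto_sum {c y : ℕ → ℝ} (hc : ∀ i, c i = 0 ∨ c i = 1)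
    (hK : Tendsto (fun n => ∑ i ∈ Finset.range n, c i) atTop atTop) {s : ℝ}
    (hs : Tendsto (fun n => ∑ i ∈ Finset.range n, c i / ((∑ j ∈ Finset.range i, c j) + 1) * y i)
      atTop (𝓝 s)) :
    Tendsto (fun n => (∑ i ∈ Finset.range n, c i * y i) / ∑ i ∈ Finset.range n, c i) atTop
      (𝓝 0) := by
  set K : ℕ → ℝ := fun n => ∑ i ∈ Finset.range n, c i with hKdef
  set S : ℕ → ℝ := fun n => ∑ i ∈ Finset.range n, c i / (K i + 1) * y i with hS
  have hc0 : ∀ i, 0 ≤ c i := fun i => by rcases hc i with h | h <;> simp [h]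
  have hK0 : ∀ n, 0 ≤ K n := fun n => Finset.sum_nonneg fun i _ => hc0 i
  have habel : ∀ n, ∑ i ∈ Finset.range n, c i * y i
      = K n * (S n - s) - ∑ i ∈ Finset.range n, c i * (S i - s) := fun n => by
    induction n with
    | zero => simp [hKdef]
    | succ n ih =>
      have h1 : K (n + 1) = K n + c n := Finset.sum_range_succ _ _
      have h2 : S (n + 1) = S n + c n / (K n + 1) * y n := Finset.sum_range_succ _ _
      rw [Finset.sum_range_succ, ih, Finset.sum_range_succ, h1, h2]
      have := hK0 n
      rcases hc n with h | h
      · simp [h]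
      · rw [h]; field_simp; ring
  have hav := tendsto_weighted_average_zero (y := fun i => S i - s) hc0 hK fun ε hε => by
    have : Tendsto (fun i => S i - s) atTop (𝓝 0) := by simpa using hs.sub_const s
    filter_upwards [this.abs.eventually_le_const (by simpa using hε)] with i hi _ using hi
  have h0 : Tendsto (fun n => (S n - s) -
      (∑ i ∈ Finset.range n, c i * (S i - s)) / K n) atTop (𝓝 0) := by
    simpa using (hs.sub_const s).sub hav
  refine h0.congr' ?_
  filter_upwards [hK.eventually_gt_atTop 0] with n hn
  have hn' : K n ≠ 0 := ne_of_gt hn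
  rw [habel, sub_div, mul_div_cancel_left₀ _ hn']

variable {Ω Z : Type*} [mΩ : MeasurableSpace Ω] [mZ : MeasurableSpace Z] {P : Measure Ω}
    [IsProbabilityMeasure P] {κ : Measure Z} [IsProbabilityMeasure κ]

/-- The `σ`-algebras generated by the first terms of a sequence of random elements. -/
def pastFiltration {Y : Type*} [MeasurableSpace Y] (ξ : ℕ → Ω → Y) (hξ : ∀ i, Measurable (ξ i)) :
    Filtration ℕ mΩ where
  seq n := MeasurableSpace.comap (fun ω (i : Set.Iio n) => ξ i ω) inferInstance
  mono' := fun n k hnk => by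
    have hR : Measurable fun (y : Set.Iio k → Y) (i : Set.Iio n) =>
        y ⟨i, lt_of_lt_of_le i.2 hnk⟩ :=
      measurable_pi_lambda _ fun i => measurable_pi_apply _
    have := MeasurableSpace.comap_mono (g := fun ω (i : Set.Iio k) => ξ i ω) hR.comap_le
    rwa [MeasurableSpace.comap_comp] at this
  le' := fun n => Measurable.comap_le (measurable_pi_lambda _ fun i => hξ i)

theorem measurable_pastFiltration {Y : Type*} [MeasurableSpace Y] {ξ : ℕ → Ω → Y}
    {hξ : ∀ i, Measurable (ξ i)} {i n : ℕ} (hi : i < n) :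
    Measurable[pastFiltration ξ hξ n] (ξ i) :=
  (measurable_pi_apply (⟨i, hi⟩ : Set.Iio n)).comp
    (comap_measurable (fun ω (i : Set.Iio n) => ξ i ω))

/-- Strong law of large numbers for adaptive sampling: the outcomes `π i` are observed at the times
`i` when `C i` occurs, which is decided without knowledge of `π i`. -/
theorem ae_tendsto_average_of_resampling {π : ℕ → Ω → Z} {upd : ℕ → Ω → Z → Ω}
    (hres : ∀ n, Resampling P κ (π n) (upd n)) {C : ℕ → Set Ω} (hC : ∀ n, MeasurableSet (C n))
    (hCinv : ∀ i n, i ≤ n → ∀ ω z, upd n ω z ∈ C i ↔ ω ∈ C i)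
    (hπinv : ∀ i n, i < n → ∀ ω z, π i (upd n ω z) = π i ω)
    {f : Z → ℝ} (hf : Measurable f) (hf2 : MemLp f 2 κ) :
    ∀ᵐ ω ∂P, Tendsto (fun n => ∑ i ∈ Finset.range n, (C i).indicator (1 : Ω → ℝ) ω) atTop atTop →
      Tendsto (fun n => (∑ i ∈ Finset.range n, (C i).indicator (1 : Ω → ℝ) ω * f (π i ω)) /
        ∑ i ∈ Finset.range n, (C i).indicator (1 : Ω → ℝ) ω) atTop (𝓝 (∫ z, f z ∂κ)) := by
  set c : ℕ → Ω → ℝ := fun i => (C i).indicator 1 with hcdef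
  set m : ℝ := ∫ z, f z ∂κ with hm
  set φ : Z → ℝ := fun z => f z - m with hφ
  have hφm : Measurable φ := hf.sub_const m
  have hφ2 : MemLp φ 2 κ := hf2.sub (memLp_const m)
  have hφ0 : ∫ z, φ z ∂κ = 0 := by
    rw [hφ, integral_sub (hf2.integrable (by norm_num)) (integrable_const _)]; simp [hm]
  set v : ℝ := ∫ z, φ z ^ 2 ∂κ with hv
  have hv0 : 0 ≤ v := integral_nonneg fun z => sq_nonneg _
  have hc01 : ∀ i ω, c i ω = 0 ∨ c i ω = 1 := fun i ω => by
    by_cases h : ω ∈ C i <;> simp [hcdef, h]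
  have hc0 : ∀ i ω, 0 ≤ c i ω := fun i ω => by rcases hc01 i ω with h | h <;> simp [h]
  have hcm : ∀ i, Measurable (c i) := fun i => measurable_one.indicator (hC i)
  have hcinv : ∀ i n, i ≤ n → ∀ ω z, c i (upd n ω z) = c i ω := fun i n hi ω z => by
    by_cases h : ω ∈ C i
    · simp [hcdef, h, (hCinv i n hi ω z).2 h]
    · simp [hcdef, h, mt (hCinv i n hi ω z).1 h]
  set K : ℕ → Ω → ℝ := fun n ω => ∑ i ∈ Finset.range n, c i ω with hK
  have hK0 : ∀ n ω, 0 ≤ K n ω := fun n ω => Finset.sum_nonneg fun i _ => hc0 i ω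
  have hKm : ∀ n, Measurable (K n) := fun n => Finset.measurable_sum _ fun i _ => hcm i
  have hKinv : ∀ i n, i ≤ n → ∀ ω z, K i (upd n ω z) = K i ω := fun i n hi ω z =>
    Finset.sum_congr rfl fun j hj => hcinv j n (by have := Finset.mem_range.1 hj; omega) ω z
  -- The `k`-th observation gets weight `1 / k`, because `K i` counts the observations strictly
  -- before time `i`.
  set g : ℕ → Ω → ℝ := fun i ω => c i ω / (K i ω + 1) with hg
  have hgm : ∀ i, Measurable (g i) := fun i => (hcm i).div ((hKm i).add_const 1)
  have hginv : ∀ i n, i ≤ n → ∀ ω z, g i (upd n ω z) = g i ω := fun i n hi ω z => by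
    simp only [hg, hcinv i n hi, hKinv i n hi]
  have hg0 : ∀ i ω, 0 ≤ g i ω := fun i ω => div_nonneg (hc0 i ω) (by have := hK0 i ω; linarith)
  have hg1 : ∀ i ω, g i ω ≤ 1 := fun i ω => by
    have := hK0 i ω
    refine div_le_one_of_le₀ ?_ (by linarith)
    rcases hc01 i ω with h | h <;> rw [h] <;> linarith
  set d : ℕ → Ω → ℝ := fun i ω => g i ω * φ (π i ω) with hd
  have hdm : ∀ i, Measurable (d i) := fun i => (hgm i).mul (hφm.comp (hres i).measurable)
  have hd2 : ∀ i, MemLp (d i) 2 P := fun i => by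
    have h1 : MemLp (φ ∘ π i) 2 P := hφ2.comp_measurePreserving (hres i).measurePreserving_coord
    refine h1.mono (hdm i).aestronglyMeasurable (Eventually.of_forall fun ω => ?_)
    simp only [hd, norm_mul, Function.comp_apply]
    refine mul_le_of_le_one_left (norm_nonneg _) ?_
    rw [Real.norm_of_nonneg (hg0 i ω)]; exact hg1 i ω
  set M : ℕ → Ω → ℝ := fun n ω => ∑ i ∈ Finset.range n, d i ω with hM
  have hMm : ∀ n, Measurable (M n) := fun n => Finset.measurable_sum _ fun i _ => hdm i
  have hM2 : ∀ n, MemLp (M n) 2 P := fun n => by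
    simpa [hM] using memLp_finsetSum (Finset.range n) fun i _ => hd2 i
  have hMi : ∀ n, Integrable (M n) P := fun n => (hM2 n).integrable (by norm_num)
  have hMinv : ∀ n ω z, M n (upd n ω z) = M n ω := fun n ω z =>
    Finset.sum_congr rfl fun j hj => by
      have hj := Finset.mem_range.1 hj
      simp only [hd, hginv j n hj.le, hπinv j n hj]
  have hMs : ∀ n ω, M (n + 1) ω = M n ω + d n ω := fun n ω => Finset.sum_range_succ _ _
  set ξ : ℕ → Ω → ℝ × Z := fun i ω => (c i ω, π i ω) with hξdef
  have hξ : ∀ i, Measurable (ξ i) := fun i => (hcm i).prodMk (hres i).measurable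
  set 𝒢 := pastFiltration ξ hξ with h𝒢
  have hadp : StronglyAdapted 𝒢 M := fun n => by
    refine Measurable.stronglyMeasurable ?_
    have hcg : ∀ i < n, Measurable[𝒢 n] (c i) := fun i hi =>
      measurable_fst.comp (measurable_pastFiltration (hξ := hξ) hi)
    have hπg : ∀ i < n, Measurable[𝒢 n] (π i) := fun i hi =>
      measurable_snd.comp (measurable_pastFiltration (hξ := hξ) hi)
    refine Finset.measurable_sum _ fun i hi => ?_
    have hi := Finset.mem_range.1 hi
    refine Measurable.mul (Measurable.div (hcg i hi) (Measurable.add_const ?_ 1))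
      (hφm.comp (hπg i hi))
    exact Finset.measurable_sum _ fun j hj => hcg j ((Finset.mem_range.1 hj).trans hi)
  have hmart : Martingale M 𝒢 P := by
    refine martingale_of_setIntegral_eq_succ hadp hMi fun n s hs => ?_
    have hs' : MeasurableSet s := 𝒢.le n s hs
    have hsinv : ∀ ω z, upd n ω z ∈ s ↔ ω ∈ s := fun ω z => by
      obtain ⟨s', -, rfl⟩ := hs
      simp only [Set.mem_preimage]
      have : (fun i : Set.Iio n => ξ i (upd n ω z)) = fun i : Set.Iio n => ξ i ω := by
        ext1 i
        simp only [hξdef, hcinv i n (le_of_lt i.2), hπinv i n i.2]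
      rw [this]
    -- Neither the past event `s` nor the weight `g n` changes when the `n`-th outcome is redrawn,
    -- while `φ` has mean zero.
    have h0 : ∫ ω in s, d n ω ∂P = 0 := by
      rw [← integral_indicator hs']
      have h1 : s.indicator (d n) = fun ω => (s.indicator (g n) ω) * φ (π n ω) := by
        ext ω
        by_cases h : ω ∈ s <;> simp [h, hd]
      rw [h1, (hres n).integral_mul ((hgm n).indicator hs') hφm, hφ0, mul_zero]
      intro ω z
      by_cases h : ω ∈ s
      · simp [h, (hsinv ω z).2 h, hginv n n le_rfl]
      · simp [h, mt (hsinv ω z).1 h]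
    simp_rw [hMs]
    rw [integral_add (hMi n).integrableOn ((hd2 n).integrable (by norm_num)).integrableOn, h0,
      add_zero]
  -- A telescoping majorant of the variances: `1 / (K + 1)^2 ≤ 2 / (K + 1) - 2 / (K + 2)`.
  set u : ℕ → Ω → ℝ := fun n ω => 2 / (K n ω + 1) with hu
  have hum : ∀ n, Measurable (u n) := fun n => measurable_const.div ((hKm n).add_const 1)
  have hu0 : ∀ n ω, 0 ≤ u n ω := fun n ω => div_nonneg two_pos.le (by have := hK0 n ω; linarith)
  have hu2 : ∀ n ω, u n ω ≤ 2 := fun n ω => by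
    have := hK0 n ω
    exact div_le_self two_pos.le (by linarith)
  have hui : ∀ n, Integrable (u n) P := fun n =>
    Integrable.of_bound (hum n).aestronglyMeasurable 2 (Eventually.of_forall fun ω => by
      rw [Real.norm_of_nonneg (hu0 n ω)]; exact hu2 n ω)
  have hg2i : ∀ n, Integrable (fun ω => g n ω ^ 2) P := fun n =>
    Integrable.of_bound ((hgm n).pow_const 2).aestronglyMeasurable 1 (Eventually.of_forall fun ω => by
      rw [Real.norm_of_nonneg (sq_nonneg _)]; exact pow_le_one₀ (hg0 n ω) (hg1 n ω))
  have hgu : ∀ n ω, g n ω ^ 2 ≤ u n ω - u (n + 1) ω := fun n ω => by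
    have h1 : K (n + 1) ω = K n ω + c n ω := Finset.sum_range_succ _ _
    have := hK0 n ω
    simp only [hg, hu, h1]
    rcases hc01 n ω with h | h
    · simp [h]
    · rw [h, div_pow, div_sub_div _ _ (by linarith) (by linarith), div_le_div_iff₀ (by positivity)
        (by positivity)]
      nlinarith [mul_nonneg this this, mul_nonneg this (mul_nonneg this this)]
  have hMd : ∀ n, Integrable (fun ω => M n ω * d n ω) P := fun n => (hM2 n).integrable_mul (hd2 n)
  -- Each step adds at most what `v * u` loses, since the cross term vanishes. The constant 2 is the
  -- value of `u 0`.
  have hbound : ∀ n, ∫ ω, M n ω ^ 2 ∂P + v * ∫ ω, u n ω ∂P ≤ v * 2 := fun n => by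
    induction n with
    | zero => simp [hM, hu, hK]
    | succ n ih =>
      have h1 : ∫ ω, M (n + 1) ω ^ 2 ∂P
          = ∫ ω, M n ω ^ 2 ∂P + 2 * ∫ ω, M n ω * d n ω ∂P + ∫ ω, d n ω ^ 2 ∂P := by
        have h : ∀ ω, M (n + 1) ω ^ 2 = M n ω ^ 2 + 2 * (M n ω * d n ω) + d n ω ^ 2 :=
          fun ω => by rw [hMs]; ring
        simp_rw [h]
        have hi : Integrable (fun ω => M n ω ^ 2 + 2 * (M n ω * d n ω)) P :=
          (hM2 n).integrable_sq.add ((hMd n).const_mul 2)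
        rw [integral_add hi (hd2 n).integrable_sq,
          integral_add (hM2 n).integrable_sq ((hMd n).const_mul 2), integral_const_mul]
      have h2 : ∫ ω, M n ω * d n ω ∂P = 0 := by
        have : (fun ω => M n ω * d n ω) = fun ω => (M n ω * g n ω) * φ (π n ω) := by
          ext ω; simp only [hd]; ring
        rw [this, (hres n).integral_mul (g := fun ω => M n ω * g n ω) ((hMm n).mul (hgm n)) hφm
          fun ω z => by rw [hMinv, hginv n n le_rfl], hφ0, mul_zero]
      have h3 : ∫ ω, d n ω ^ 2 ∂P = (∫ ω, g n ω ^ 2 ∂P) * v := by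
        rw [← (hres n).integral_mul ((hgm n).pow_const 2) (hφm.pow_const 2)]
        · exact integral_congr_ae (Eventually.of_forall fun ω => by simp only [hd]; ring)
        · intro ω z; rw [hginv n n le_rfl]
      have h4 : ∫ ω, g n ω ^ 2 ∂P ≤ ∫ ω, u n ω ∂P - ∫ ω, u (n + 1) ω ∂P := by
        rw [← integral_sub (hui n) (hui _)]
        exact integral_mono (hg2i n) ((hui n).sub (hui _)) (hgu n)
      rw [h1, h2, h3]
      nlinarith
  have hL1 : ∀ n, eLpNorm (M n) 1 P ≤ (Real.toNNReal (1 + v * 2) : ℝ≥0) := fun n => by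
    rw [eLpNorm_one_eq_lintegral_enorm, ← ofReal_integral_norm_eq_lintegral_enorm (hMi n)]
    refine ENNReal.ofReal_le_ofReal ?_
    calc ∫ ω, ‖M n ω‖ ∂P ≤ ∫ ω, (1 + M n ω ^ 2) ∂P :=
          integral_mono (hMi n).norm ((integrable_const 1).add (hM2 n).integrable_sq) fun ω => by
            simp only [Real.norm_eq_abs]
            nlinarith [sq_nonneg (|M n ω| - 1), sq_abs (M n ω), abs_nonneg (M n ω)]
      _ = 1 + ∫ ω, M n ω ^ 2 ∂P := by
          rw [integral_add (integrable_const 1) (hM2 n).integrable_sq]; simp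
      _ ≤ 1 + v * 2 := by
          have := hbound n
          have h5 : 0 ≤ v * ∫ ω, u n ω ∂P := mul_nonneg hv0 (integral_nonneg (hu0 n))
          linarith
  filter_upwards [hmart.submartingale.ae_tendsto_limitProcess hL1] with ω hω hKω
  have h := tendsto_average_zero_of_tendsto_sum (c := fun i => c i ω) (y := fun i => φ (π i ω))
    (fun i => hc01 i ω) hKω hω
  have h' := h.add_const m
  rw [zero_add] at h'
  refine h'.congr' ?_
  filter_upwards [hKω.eventually_gt_atTop 0] with n hn
  have hn' : (∑ i ∈ Finset.range n, c i ω) ≠ 0 := ne_of_gt hn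
  rw [div_add' _ _ _ hn']
  congr 1
  rw [Finset.mul_sum, ← Finset.sum_add_distrib]
  exact Finset.sum_congr rfl fun i _ => by simp only [hφ]; ring

end AdaptiveLLN

/-! ### Redrawing a single outcome in the noise of the algorithm -/

section NoiseResampling

variable {X A : Type*} [Fintype X] [MeasurableSpace X] [Fintype A] [DecidableEq X] [DecidableEq A]

/-- Replace the outcome of action `a` in state `x`. -/
def setOutcome (x : X) (a : A) (o : X → A → ℝ × X) (z : ℝ × X) : X → A → ℝ × X :=
  Function.update o x (Function.update (o x) a z)

theorem setOutcome_self (x : X) (a : A) (o : X → A → ℝ × X) (z : ℝ × X) :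
    setOutcome x a o z x a = z := by simp [setOutcome]

theorem measurePreserving_setOutcome (D : Dynamics X A) (t : ℕ) (x : X) (a : A) :
    MeasurePreserving (fun p : (X → A → ℝ × X) × (ℝ × X) => setOutcome x a p.1 p.2)
      ((D.stageLaw t).prod (D.law t x a)) (D.stageLaw t) := by
  refine measurePreserving_update_pi (fun x => Measure.pi fun a => D.law t x a) (D.law t x a) x
    (fun o z => Function.update o a z) ?_
  exact measurePreserving_update_pi (fun a => D.law t x a) (D.law t x a) a (fun _ z => z)
    measurePreserving_snd

theorem resampling_outcomes (D : Dynamics X A) (t : ℕ) (x : X) (a : A) :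
    Resampling (Measure.infinitePi D.stageLaw) (D.law t x a) (fun w => w t x a)
      (fun w z => Function.update w t (setOutcome x a (w t) z)) where
  preserving := measurePreserving_update_infinitePi D.stageLaw (D.law t x a) t
    (fun o z => setOutcome x a o z) (measurePreserving_setOutcome D t x a)
  coord := fun w z => by simp [setOutcome_self]
  measurable := by fun_prop

/-- Replace the outcome of action `a` in state `x` at stage `t` of rollout `n`. -/
def redraw (n t : ℕ) (x : X) (a : A) (ω : ℕ → ℕ → Noise X A) (z : ℝ × X) : ℕ → ℕ → Noise X A :=
  Function.update ω n (Function.update (ω n) t (setOutcome x a (ω n t).1 z, (ω n t).2))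

theorem resampling_redraw (D : Dynamics X A) (ν : Measure (ChoiceRule A)) [IsProbabilityMeasure ν]
    (n t : ℕ) (x : X) (a : A) :
    Resampling (runLaw D ν) (D.law t x a) (fun ω => (ω n t).1 x a) (redraw n t x a) where
  preserving := by
    refine measurePreserving_update_infinitePi
      (fun _ : ℕ => Measure.infinitePi fun t : ℕ => (D.stageLaw t).prod ν) (D.law t x a) n
      (fun w z => Function.update w t (setOutcome x a (w t).1 z, (w t).2)) ?_
    refine measurePreserving_update_infinitePi
      (fun t : ℕ => (D.stageLaw t).prod ν) (D.law t x a) t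
      (fun o z => (setOutcome x a o.1 z, o.2)) ?_
    have h1 := (measurePreserving_setOutcome D t x a).prod (MeasurePreserving.id ν)
    -- Reorder the factors so that the new outcome stands next to the old ones; the choice rule is
    -- carried along unchanged.
    have h2 : MeasurePreserving (fun p : ((X → A → ℝ × X) × ChoiceRule A) × (ℝ × X) =>
        ((p.1.1, p.2), p.1.2)) (((D.stageLaw t).prod ν).prod (D.law t x a))
        (((D.stageLaw t).prod (D.law t x a)).prod ν) := by
      refine ⟨by fun_prop, ?_⟩
      have e1 := (measurePreserving_prodAssoc (D.stageLaw t) (D.law t x a) ν).symm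
      have e2 := (MeasurePreserving.id (D.stageLaw t)).prod
        (Measure.measurePreserving_swap (μ := ν) (ν := D.law t x a))
      have e3 := measurePreserving_prodAssoc (D.stageLaw t) ν (D.law t x a)
      exact ((e1.comp e2).comp e3).map_eq
    exact h1.comp h2
  coord := fun w z => by simp [redraw, setOutcome_self]
  measurable := by fun_prop

instance (D : Dynamics X A) (ν : Measure (ChoiceRule A)) [IsProbabilityMeasure ν] :
    IsProbabilityMeasure (runLaw D ν) := by
  unfold runLaw; infer_instance

end NoiseResampling

/-! ### Backward induction and Bellman's equation -/

section Bellman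

variable {X A : Type*} [Fintype X] [MeasurableSpace X] [MeasurableSingletonClass X] [Fintype A]

/-- Expected reward plus expected continuation value `V`. -/
def backup (D : Dynamics X A) (t : ℕ) (V : X → ℝ) (x : X) (a : A) : ℝ :=
  ∫ z, z.1 ∂(D.law t x a) + ∑ y, D.trans t x a y * V y

/-- Optimal value with `k` stages to go, by backward induction. -/
def valueIter (G : Model X A) (D : Dynamics X A) : ℕ → ℕ → X → ℝ
  | 0, _, _ => 0
  | k + 1, t, x =>
    (G.avail x).sup' (G.avail_nonempty x) (backup D t (valueIter G D k (t + 1)) x)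

/-- Rewards of available actions have finite expectation. -/
def IntegrableRewards (G : Model X A) (D : Dynamics X A) : Prop :=
  ∀ t < G.horizon, ∀ x, ∀ a ∈ G.avail x, Integrable (fun z : ℝ × X => z.1) (D.law t x a)

theorem Dynamics.trans_nonneg (D : Dynamics X A) (t : ℕ) (x : X) (a : A) (y : X) :
    0 ≤ D.trans t x a y := measureReal_nonneg

theorem measurable_of_snd (f : X → ℝ) : Measurable fun z : ℝ × X => f z.2 :=
  (measurable_of_finite f).comp measurable_snd

theorem integrable_of_snd (D : Dynamics X A) (t : ℕ) (x : X) (a : A) (f : X → ℝ) :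
    Integrable (fun z : ℝ × X => f z.2) (D.law t x a) := by
  classical
  refine Integrable.of_bound (measurable_of_snd f).aestronglyMeasurable (∑ y, ‖f y‖)
    (Eventually.of_forall fun z => ?_)
  exact Finset.single_le_sum (f := fun y => ‖f y‖) (fun y _ => norm_nonneg _) (Finset.mem_univ z.2)

theorem integral_of_snd (D : Dynamics X A) (t : ℕ) (x : X) (a : A) (f : X → ℝ) :
    ∫ z, f z.2 ∂(D.law t x a) = ∑ y, D.trans t x a y * f y := by
  classical
  have h : ∀ z : ℝ × X, f z.2 = ∑ y, (Prod.snd ⁻¹' {y} : Set (ℝ × X)).indicator 1 z * f y := by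
    intro z
    rw [Finset.sum_eq_single z.2] <;> simp +contextual [eq_comm]
  simp_rw [h]
  have hms : ∀ y : X, MeasurableSet (Prod.snd ⁻¹' {y} : Set (ℝ × X)) := fun y =>
    measurable_snd (measurableSet_singleton y)
  rw [integral_finsetSum _ fun y _ => ((integrable_const 1).indicator (hms y)).mul_const _]
  refine Finset.sum_congr rfl fun y _ => ?_
  rw [integral_mul_const, integral_indicator_one (hms y), Dynamics.trans]

variable [DecidableEq X] [DecidableEq A]

/-- The return from stage `t` reads no earlier stage. This is what makes the continuation
independent of the outcome that leads to it. -/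
theorem policyReturn_update (p : ℕ → X → A) (w : ℕ → X → A → ℝ × X) {s : ℕ}
    (o : X → A → ℝ × X) : ∀ k t x, s < t →
      policyReturn p (Function.update w s o) k t x = policyReturn p w k t x
  | 0, _, _, _ => rfl
  | k + 1, t, x, h => by
    simp only [policyReturn, Function.update_of_ne h.ne']
    rw [policyReturn_update p w o k (t + 1) _ (by omega)]

theorem measurable_policyReturn (p : ℕ → X → A) : ∀ k t x,
    Measurable fun w : ℕ → X → A → ℝ × X => policyReturn p w k t x
  | 0, _, _ => measurable_const
  | k + 1, t, x => by
    refine Measurable.add (by fun_prop) ?_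
    have h : Measurable fun q : (ℕ → X → A → ℝ × X) × X => policyReturn p q.1 k (t + 1) q.2 :=
      measurable_from_prod_countable_left fun y => measurable_policyReturn p k (t + 1) y
    exact h.comp (f := fun w : ℕ → X → A → ℝ × X => (w, (w t x (p t x)).2)) (by fun_prop)

/-- The return splits over the finitely many next states `y`: for fixed `y`, the continuation from
`y` is independent of the indicator that `y` occurs. Integrability of this continuation is the
induction hypothesis, and the recursion for the expectation uses the same splitting, so both are
proved together. -/
theorem integrable_policyReturn {G : Model X A} {D : Dynamics X A} (hD : IntegrableRewards G D)
    (p : Policy G) : ∀ k t x, t + k = G.horizon →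
      Integrable (fun w => policyReturn p.1 w k t x) (Measure.infinitePi D.stageLaw) ∧
      ∀ l, k = l + 1 → ∫ w, policyReturn p.1 w k t x ∂(Measure.infinitePi D.stageLaw) =
        backup D t (fun y => ∫ w, policyReturn p.1 w l (t + 1) y ∂(Measure.infinitePi D.stageLaw))
          x (p.1 t x)
  | 0, _, _, _ => ⟨integrable_const 0, by simp⟩
  | k + 1, t, x, h => by
    set P := Measure.infinitePi D.stageLaw
    have hres := resampling_outcomes D t x (p.1 t x)
    have hmp := hres.measurePreserving_coord
    have hr : Integrable (fun w : ℕ → X → A → ℝ × X => (w t x (p.1 t x)).1) P :=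
      hmp.integrable_comp_of_integrable (hD t (by omega) x _ (p.2 t x))
    set f : X → ℝ × X → ℝ := fun y => (Prod.snd ⁻¹' {y} : Set (ℝ × X)).indicator 1 with hf
    have hms : ∀ y : X, MeasurableSet (Prod.snd ⁻¹' {y} : Set (ℝ × X)) := fun y =>
      measurable_snd (measurableSet_singleton y)
    have hfm : ∀ y, Measurable (f y) := fun y => measurable_one.indicator (hms y)
    have hfi : ∀ y, Integrable (f y) (D.law t x (p.1 t x)) := fun y =>
      (integrable_const 1).indicator (hms y)
    have hinv : ∀ y w z, policyReturn p.1
        (Function.update w t (setOutcome x (p.1 t x) (w t) z)) k (t + 1) y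
          = policyReturn p.1 w k (t + 1) y := fun y w z =>
      policyReturn_update _ _ _ _ _ _ (by omega)
    have hsplit : ∀ w : ℕ → X → A → ℝ × X, policyReturn p.1 w (k + 1) t x
        = (w t x (p.1 t x)).1 +
          ∑ y, policyReturn p.1 w k (t + 1) y * f y (w t x (p.1 t x)) := fun w => by
      rw [policyReturn, Finset.sum_eq_single (w t x (p.1 t x)).2] <;>
        simp +contextual [hf, eq_comm]
    have hI : ∀ y, Integrable (fun w => policyReturn p.1 w k (t + 1) y * f y (w t x (p.1 t x))) P :=
      fun y => hres.integrable_mul (integrable_policyReturn hD p k (t + 1) y (by omega)).1 (hfi y)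
        (measurable_policyReturn _ _ _ _) (hfm y) (hinv y)
    simp_rw [hsplit]
    refine ⟨hr.add (integrable_finsetSum _ fun y _ => hI y), fun l hl => ?_⟩
    obtain rfl : l = k := by omega
    rw [integral_add hr (integrable_finsetSum _ fun y _ => hI y),
      integral_finsetSum _ fun y _ => hI y, backup]
    congr 1
    · rw [← hmp.map_eq, integral_map hmp.measurable.aemeasurable (by fun_prop)]
    · refine Finset.sum_congr rfl fun y _ => ?_
      rw [hres.integral_mul (measurable_policyReturn _ _ _ _) (hfm y) (hinv y), hf,
        integral_indicator_one (hms y), mul_comm]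
      rfl

theorem backup_mono (D : Dynamics X A) {t : ℕ} {U V : X → ℝ} (h : ∀ y, U y ≤ V y) (x : X)
    (a : A) : backup D t U x a ≤ backup D t V x a :=
  add_le_add_right (Finset.sum_le_sum fun y _ =>
    mul_le_mul_of_nonneg_left (h y) (D.trans_nonneg t x a y)) _

theorem integral_policyReturn_le {G : Model X A} {D : Dynamics X A} (hD : IntegrableRewards G D)
    (p : Policy G) : ∀ k t x, t + k = G.horizon →
      ∫ w, policyReturn p.1 w k t x ∂(Measure.infinitePi D.stageLaw) ≤ valueIter G D k t x
  | 0, _, _, _ => by simp [policyReturn, valueIter]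
  | k + 1, t, x, h => by
    rw [(integrable_policyReturn hD p (k + 1) t x h).2 k rfl, valueIter]
    refine (backup_mono D (fun y => integral_policyReturn_le hD p k (t + 1) y (by omega)) x
      _).trans ?_
    exact Finset.le_sup' (backup D t (valueIter G D k (t + 1)) x) (p.2 t x)

/-- The policy that is greedy with respect to backward induction. -/
def greedyPolicy (G : Model X A) (D : Dynamics X A) : Policy G :=
  ⟨fun t x => ((G.avail x).exists_mem_eq_sup' (G.avail_nonempty x)
    (backup D t (valueIter G D (G.horizon - (t + 1)) (t + 1)) x)).choose,
  fun t x => ((G.avail x).exists_mem_eq_sup' (G.avail_nonempty x)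
    (backup D t (valueIter G D (G.horizon - (t + 1)) (t + 1)) x)).choose_spec.1⟩

theorem integral_policyReturn_greedyPolicy {G : Model X A} {D : Dynamics X A}
    (hD : IntegrableRewards G D) : ∀ k t x, t + k = G.horizon →
      ∫ w, policyReturn (greedyPolicy G D).1 w k t x ∂(Measure.infinitePi D.stageLaw)
        = valueIter G D k t x
  | 0, _, _, _ => by simp [policyReturn, valueIter]
  | k + 1, t, x, h => by
    rw [(integrable_policyReturn hD _ (k + 1) t x h).2 k rfl, valueIter]
    simp_rw [fun y => integral_policyReturn_greedyPolicy hD k (t + 1) y (by omega)]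
    obtain rfl : k = G.horizon - (t + 1) := by omega
    exact ((G.avail x).exists_mem_eq_sup' (G.avail_nonempty x)
      (backup D t (valueIter G D (G.horizon - (t + 1)) (t + 1)) x)).choose_spec.2.symm

/-- Backward induction bounds every policy value, so the real supremum is a genuine one, and the
greedy policy attains the bound. -/
theorem Vstar_eq_valueIter {G : Model X A} {D : Dynamics X A} (hD : IntegrableRewards G D)
    {t : ℕ} (ht : t ≤ G.horizon) (x : X) : Vstar G D t x = valueIter G D (G.horizon - t) t x := by
  have hle : ∀ p : Policy G, policyValue G D p t x ≤ valueIter G D (G.horizon - t) t x := fun p =>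
    integral_policyReturn_le hD p _ t x (by omega)
  have : Nonempty (Policy G) := ⟨greedyPolicy G D⟩
  refine le_antisymm (ciSup_le hle) ?_
  rw [← integral_policyReturn_greedyPolicy hD (G.horizon - t) t x (by omega)]
  exact le_ciSup (f := fun p => policyValue G D p t x) ⟨_, Set.forall_mem_range.2 hle⟩
    (greedyPolicy G D)

theorem Vstar_horizon {G : Model X A} {D : Dynamics X A} (hD : IntegrableRewards G D) (x : X) :
    Vstar G D G.horizon x = 0 := by
  rw [Vstar_eq_valueIter hD le_rfl, Nat.sub_self, valueIter]

/-- Bellman's optimality equation. -/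
theorem Vstar_eq_sup'_Qstar {G : Model X A} {D : Dynamics X A} (hD : IntegrableRewards G D)
    {t : ℕ} (ht : t < G.horizon) (x : X) :
    Vstar G D t x = (G.avail x).sup' (G.avail_nonempty x) (Qstar G D t x) := by
  obtain ⟨k, hk⟩ : ∃ k, G.horizon - t = k + 1 := ⟨G.horizon - t - 1, by omega⟩
  rw [Vstar_eq_valueIter hD ht.le, hk, valueIter]
  congr 1
  ext a
  simp_rw [backup, Qstar, Vstar_eq_valueIter hD (show t + 1 ≤ G.horizon from ht)]
  rw [show G.horizon - (t + 1) = k by omega]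

theorem measurable_cumReward (G : Model X A) (D : Dynamics X A) (t : ℕ) :
    Measurable (cumReward G D t) :=
  measurable_fst.add (measurable_of_snd _)

theorem integral_cumReward {G : Model X A} {D : Dynamics X A} (hD : IntegrableRewards G D)
    {t : ℕ} (ht : t < G.horizon) {x : X} {a : A} (ha : a ∈ G.avail x) :
    ∫ z, cumReward G D t z ∂(D.law t x a) = Qstar G D t x a := by
  unfold cumReward
  rw [integral_add (hD t ht x a ha) (integrable_of_snd D t x a _), integral_of_snd, Qstar]

variable {G : Model X A} {D : Dynamics X A} {t : ℕ} {x : X} {a : A} {μ : ℝ} {v : ℝ≥0}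

theorem memLp_cumReward_of_map_eq (h : (D.law t x a).map (cumReward G D t) = gaussianReal μ v) :
    MemLp (cumReward G D t) 2 (D.law t x a) := by
  have := memLp_id_gaussianReal (μ := μ) (v := v) 2
  rw [← h] at this
  exact (memLp_map_measure_iff (by fun_prop) (measurable_cumReward G D t).aemeasurable).1 this

/-- Any function of the next state is bounded because `X` is finite, so subtracting `Vstar` from an
integrable normal variable leaves an integrable reward. Nothing about `Vstar` is needed, which
avoids a circle: its evaluation by backward induction presupposes integrable rewards. -/
theorem integrable_reward_of_map_eq (h : (D.law t x a).map (cumReward G D t) = gaussianReal μ v) :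
    Integrable (fun z : ℝ × X => z.1) (D.law t x a) := by
  have h1 := ((memLp_cumReward_of_map_eq h).integrable (by norm_num)).sub
    (integrable_of_snd D t x a (Vstar G D (t + 1)))
  refine h1.congr (Eventually.of_forall fun z => ?_)
  simp [cumReward]

theorem integral_cumReward_of_map_eq
    (h : (D.law t x a).map (cumReward G D t) = gaussianReal μ v) :
    ∫ z, cumReward G D t z ∂(D.law t x a) = μ := by
  rw [← integral_id_gaussianReal (μ := μ) (v := v), ← h,
    integral_map (measurable_cumReward G D t).aemeasurable (by fun_prop)]

theorem measure_singleton_of_map_eq (hv : v ≠ 0)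
    (h : (D.law t x a).map (cumReward G D t) = gaussianReal μ v) (z : ℝ × X) :
    D.law t x a {z} = 0 := by
  have : NullSingletonClass (gaussianReal μ v) := nullSingletonClass_gaussianReal hv
  refine measure_mono_null (t := cumReward G D t ⁻¹' {cumReward G D t z}) (by simp) ?_
  rw [← Measure.map_apply (measurable_cumReward G D t) (measurableSet_singleton _), h]
  exact measure_singleton _

end Bellman

/-! ### The effect of one rollout on the statistics -/

section RolloutStructure

variable {X A : Type*} [DecidableEq X] [DecidableEq A] (G : Model X A) (P : Params X A)

/-- The action taken at the state node `(t, x)` when a path arrives there. -/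
def act (s : Stats X A) (c : ChoiceRule A) (t : ℕ) (x : X) : A :=
  if (unexpanded G P s t x).Nonempty then c.1 (unexpanded G P s t x) else ocbaSelect G P s c t x

/-- The outcome of the action taken at `(t, x)`. -/
def outcome (s : Stats X A) (w : ℕ → Noise X A) (t : ℕ) (x : X) : ℝ × X :=
  (w t).1 x (act G P s (w t).2 t x)

/-- The statistics after simulation from the leaf `(t, y)`. -/
def leafStats (s : Stats X A) (w : ℕ → Noise X A) (t : ℕ) (y : X) : Stats X A :=
  leafUpdate s t y (simulate G w (G.horizon - t) t y)

/-- The part of a rollout that starts at the node `(t, x)` with `k` stages to go. -/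
def descend (s : Stats X A) (w : ℕ → Noise X A) : ℕ → ℕ → X → Stats X A
  | 0, t, x => leafStats G s w t x
  | k + 1, t, x =>
    nodeUpdate G P
      ⟨t, x, act G P s (w t).2 t x, (outcome G P s w t x).1, (outcome G P s w t x).2⟩
      (if (unexpanded G P s t x).Nonempty then leafStats G s w (t + 1) (outcome G P s w t x).2
        else descend s w k (t + 1) (outcome G P s w t x).2)

/-- Selection reads only the statistics before the rollout, so it can be merged with backpropagation
into one recursion along the path. -/
theorem foldr_selection (s : Stats X A) (w : ℕ → Noise X A) : ∀ k t x,
    (selection G P s w k t x).1.foldr (nodeUpdate G P)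
      (leafStats G s w (selection G P s w k t x).2.1 (selection G P s w k t x).2.2)
      = descend G P s w k t x
  | 0, _, _ => rfl
  | k + 1, t, x => by
    by_cases h : (unexpanded G P s t x).Nonempty
    · simp [selection, descend, h, outcome, act]
    · simp only [selection, descend, h, if_false, List.foldr_cons, outcome, act]
      rw [← foldr_selection s w k]

theorem rollout_eq_descend (x₀ : X) (s : Stats X A) (w : ℕ → Noise X A) :
    rollout G P x₀ s w = descend G P s w G.horizon 0 x₀ :=
  foldr_selection G P s w _ _ _

/-- The path of the rollout from `x₀` passes through the node `(t, x)`, and does not end there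
before the horizon. -/
def OnPath (x₀ : X) (s : Stats X A) (w : ℕ → Noise X A) : ℕ → X → Prop
  | 0, x => x = x₀
  | t + 1, y => ∃ x, OnPath x₀ s w t x ∧ ¬(unexpanded G P s t x).Nonempty ∧
      (outcome G P s w t x).2 = y

/-- The statistics of all nodes at stage `t` agree. -/
def RowsEq (s s' : Stats X A) (t : ℕ) : Prop :=
  s.N t = s'.N t ∧ s.NA t = s'.NA t ∧ s.Qbar t = s'.Qbar t ∧ s.Vbar t = s'.Vbar t ∧
    s.Vhat t = s'.Vhat t

variable {G P} {x₀ : X} {s s' s'' : Stats X A} {w : ℕ → Noise X A}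

theorem RowsEq.refl (s : Stats X A) (t : ℕ) : RowsEq s s t := ⟨rfl, rfl, rfl, rfl, rfl⟩

theorem RowsEq.trans {t : ℕ} (h : RowsEq s s' t) (h' : RowsEq s' s'' t) : RowsEq s s'' t :=
  ⟨h.1.trans h'.1, h.2.1.trans h'.2.1, h.2.2.1.trans h'.2.2.1, h.2.2.2.1.trans h'.2.2.2.1,
    h.2.2.2.2.trans h'.2.2.2.2⟩

theorem setAt_of_ne {β : Type*} (f : ℕ → X → β) {t t' : ℕ} (h : t' ≠ t) (x : X) (v : β) :
    setAt f t x v t' = f t' := by simp [setAt, h]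

theorem setAt_self {β : Type*} (f : ℕ → X → β) (t : ℕ) (x : X) (v : β) :
    setAt f t x v t = Function.update (f t) x v := by simp [setAt]

theorem rowsEq_leafUpdate {t t' : ℕ} (h : t' ≠ t) (x : X) (r : ℝ) :
    RowsEq (leafUpdate s t x r) s t' := by
  simp [RowsEq, leafUpdate, setAt_of_ne _ h]

theorem rowsEq_nodeUpdate {e : PathStep X A} {t' : ℕ} (h : t' ≠ e.t) :
    RowsEq (nodeUpdate G P e s) s t' := by
  simp [RowsEq, nodeUpdate, setAt_of_ne _ h]

theorem rowsEq_leafStats {t t' : ℕ} (h : t' ≠ t) (x : X) :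
    RowsEq (leafStats G s w t x) s t' := rowsEq_leafUpdate h _ _

/-- The part of a rollout from stage `t` on writes only to stages from `t` on. A node update
therefore still finds the old statistics in its own row. -/
theorem rowsEq_descend_of_lt : ∀ k t x, ∀ t' < t, RowsEq (descend G P s w k t x) s t'
  | 0, _, _, _, h => rowsEq_leafStats h.ne _
  | k + 1, t, x, t', h => by
    rw [descend]
    refine (rowsEq_nodeUpdate h.ne).trans ?_
    split_ifs
    · exact rowsEq_leafStats (by omega) _
    · exact rowsEq_descend_of_lt k (t + 1) _ t' (by omega)

theorem OnPath.unique : ∀ {t : ℕ} {x y : X}, OnPath G P x₀ s w t x → OnPath G P x₀ s w t y → x = y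
  | 0, _, _, h, h' => h.trans h'.symm
  | _ + 1, _, _, ⟨_, h, _, e⟩, ⟨_, h', _, e'⟩ => by rw [← e, ← e', h.unique h']

/-- The effect of a rollout on the stages from `t` on. -/
theorem rollout_cases : ∀ {t : ℕ}, t ≤ G.horizon →
    (∃ x, OnPath G P x₀ s w t x ∧ ∀ t' ≥ t,
      RowsEq (rollout G P x₀ s w) (descend G P s w (G.horizon - t) t x) t') ∨
    ((∀ x, ¬OnPath G P x₀ s w t x) ∧ ∃ u x, t = u + 1 ∧ OnPath G P x₀ s w u x ∧
      (unexpanded G P s u x).Nonempty ∧ ∀ t' ≥ t,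
      RowsEq (rollout G P x₀ s w) (leafStats G s w t (outcome G P s w u x).2) t') ∨
    ((∀ x, ¬OnPath G P x₀ s w t x) ∧ ∀ t' ≥ t, RowsEq (rollout G P x₀ s w) s t')
  | 0, _ => Or.inl ⟨x₀, rfl, fun t' _ => by rw [rollout_eq_descend]; exact RowsEq.refl _ _⟩
  | t + 1, ht => by
    rcases rollout_cases (t := t) (by omega) with ⟨x, hx, h⟩ | ⟨hn, u, x, -, hx, -, h⟩ | ⟨hn, h⟩
    · obtain ⟨k, hk⟩ : ∃ k, G.horizon - t = k + 1 := ⟨G.horizon - t - 1, by omega⟩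
      rw [hk, descend] at h
      by_cases hu : (unexpanded G P s t x).Nonempty
      · refine Or.inr (Or.inl ⟨?_, t, x, rfl, hx, hu, fun t' ht' => (h t' (by omega)).trans ?_⟩)
        · rintro y ⟨x', hx', hu', -⟩
          exact hu' (hx.unique hx' ▸ hu)
        · rw [if_pos hu]; exact rowsEq_nodeUpdate (by simp only; omega)
      · refine Or.inl ⟨_, ⟨x, hx, hu, rfl⟩, fun t' ht' => (h t' (by omega)).trans ?_⟩
        rw [if_neg hu, show G.horizon - (t + 1) = k by omega]
        exact rowsEq_nodeUpdate (by simp only; omega)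
    · refine Or.inr (Or.inr ⟨?_, fun t' ht' =>
        (h t' (by omega)).trans (rowsEq_leafStats (by omega) _)⟩)
      rintro y ⟨x', hx', -, -⟩
      exact hn x' hx'
    · refine Or.inr (Or.inr ⟨?_, fun t' ht' => h t' (by omega)⟩)
      rintro y ⟨x', hx', -, -⟩
      exact hn x' hx'

/-- Backpropagation runs from the leaf to the root, so the value of the next node that enters the
sample mean is the one after the rollout. -/
theorem rollout_of_onPath {t : ℕ} {x : X} (ht : t < G.horizon) (hx : OnPath G P x₀ s w t x) :
    let s' := rollout G P x₀ s w
    let a := act G P s (w t).2 t x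
    let z := outcome G P s w t x
    let m : ℝ := (s.NA t x a + 1 : ℕ)
    let n := s.N t x + 1
    s'.N t x = n ∧ s'.NA t x = Function.update (s.NA t x) a (s.NA t x a + 1) ∧
    s'.Qbar t x = Function.update (s.Qbar t x) a
      ((m - 1) / m * s.Qbar t x a + 1 / m * (z.1 + s'.Vhat (t + 1) z.2)) ∧
    s'.Vbar t x = ((n : ℝ) - 1) / n * s.Vbar t x + 1 / n * s'.Qbar t x a ∧
    s'.Vhat t x = (1 - P.α n) * s'.Vbar t x +
      P.α n * (G.avail x).sup' (G.avail_nonempty x) (s'.Qbar t x) := by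
  intro s' a z m n
  rcases rollout_cases (G := G) (P := P) (x₀ := x₀) (s := s) (w := w) ht.le with
    ⟨x', hx', h⟩ | ⟨hn, -⟩ | ⟨hn, -⟩
  · obtain rfl := hx.unique hx'
    obtain ⟨k, hk⟩ : ∃ k, G.horizon - t = k + 1 := ⟨G.horizon - t - 1, by omega⟩
    rw [hk, descend] at h
    set s₁ := (if (unexpanded G P s t x).Nonempty then
      leafStats G s w (t + 1) (outcome G P s w t x).2
        else descend G P s w k (t + 1) (outcome G P s w t x).2) with hs₁
    have h₁ : RowsEq s₁ s t := by
      rw [hs₁]; split_ifs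
      · exact rowsEq_leafStats (by omega) _
      · exact rowsEq_descend_of_lt k (t + 1) _ t (by omega)
    obtain ⟨e1, e2, e3, e4, e5⟩ := h t le_rfl
    have e6 := (h (t + 1) (by omega)).2.2.2.2
    obtain ⟨f1, f2, f3, f4, -⟩ := h₁
    rw [(rowsEq_nodeUpdate (s := s₁) (by simp)).2.2.2.2] at e6
    simp only [nodeUpdate, setAt_self, f1, f2, f3, f4, ← e6] at e1 e2 e3 e4 e5
    have g3 : s'.Qbar t x = Function.update (s.Qbar t x) a
      ((m - 1) / m * s.Qbar t x a + 1 / m * (z.1 + s'.Vhat (t + 1) z.2)) := by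
      simp only [s', e3, Function.update_self]; rfl
    have g4 : s'.Vbar t x = ((n : ℝ) - 1) / n * s.Vbar t x + 1 / n * s'.Qbar t x a := by
      rw [g3]; simp only [s', e4, Function.update_self]; rfl
    refine ⟨?_, ?_, g3, g4, ?_⟩
    · simp [s', e1, n]
    · simp only [s', e2, Function.update_self]; rfl
    · rw [g4, g3]; simp only [s', e5, Function.update_self]; rfl
  · exact absurd hx (hn x)
  · exact absurd hx (hn x)

/-- A node outside `OnPath` may still be the leaf of an expansion. Then its visit count and `Vhat`
change, which is why the count is only compared and `Vhat` needs a condition on the previous stage.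
-/
theorem rollout_of_not_onPath {t : ℕ} {x : X} (ht : t < G.horizon)
    (hx : ¬OnPath G P x₀ s w t x) :
    let s' := rollout G P x₀ s w
    s.N t x ≤ s'.N t x ∧ s'.NA t x = s.NA t x ∧ s'.Qbar t x = s.Qbar t x ∧
    s'.Vbar t x = s.Vbar t x ∧
    ((∀ u x', t = u + 1 → OnPath G P x₀ s w u x' → ¬(unexpanded G P s u x').Nonempty) →
      s'.Vhat t x = s.Vhat t x) := by
  intro s'
  rcases rollout_cases (G := G) (P := P) (x₀ := x₀) (s := s) (w := w) ht.le with
    ⟨x', hx', h⟩ | ⟨hn, u, x', hu, hx', hu', h⟩ | ⟨hn, h⟩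
  · have hne : x ≠ x' := fun e => hx (e ▸ hx')
    obtain ⟨k, hk⟩ : ∃ k, G.horizon - t = k + 1 := ⟨G.horizon - t - 1, by omega⟩
    rw [hk, descend] at h
    set s₁ := (if (unexpanded G P s t x').Nonempty then
      leafStats G s w (t + 1) (outcome G P s w t x').2
        else descend G P s w k (t + 1) (outcome G P s w t x').2) with hs₁
    have h₁ : RowsEq s₁ s t := by
      rw [hs₁]; split_ifs
      · exact rowsEq_leafStats (by omega) _
      · exact rowsEq_descend_of_lt k (t + 1) _ t (by omega)
    obtain ⟨e1, e2, e3, e4, e5⟩ := h t le_rfl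
    obtain ⟨f1, f2, f3, f4, f5⟩ := h₁
    simp only [nodeUpdate, setAt_self, f1, f2, f3, f4, f5] at e1 e2 e3 e4 e5
    refine ⟨?_, ?_, ?_, ?_, fun _ => ?_⟩
    · simp [s', e1, hne]
    · simp [s', e2, hne]
    · simp [s', e3, hne]
    · simp [s', e4, hne]
    · simp [s', e5, hne]
  · obtain ⟨e1, e2, e3, e4, e5⟩ := h t le_rfl
    simp only [leafStats, leafUpdate] at e1 e2 e3 e4 e5
    refine ⟨?_, congrFun e2 x, congrFun e3 x, congrFun e4 x, fun H => absurd hu' (H u x' hu hx')⟩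
    simp only [s', e1, setAt_self]
    by_cases hxy : x = (outcome G P s w u x').2
    · rw [← hxy]; simp
    · simp [hxy]
  · obtain ⟨e1, e2, e3, e4, e5⟩ := h t le_rfl
    exact ⟨(congrFun e1 x).ge, congrFun e2 x, congrFun e3 x, congrFun e4 x, fun _ => congrFun e5 x⟩

theorem Vhat_rollout_horizon (h0 : ∀ x, s.Vhat G.horizon x = 0) (x : X) :
    (rollout G P x₀ s w).Vhat G.horizon x = 0 := by
  have hleaf : ∀ y, (leafStats G s w G.horizon y).Vhat G.horizon x = 0 := fun y => by
    simp only [leafStats, leafUpdate, Nat.sub_self, simulate, setAt_self, h0]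
    by_cases h : x = y
    · subst h; simp
    · simp [h, h0]
  rcases rollout_cases (G := G) (P := P) (x₀ := x₀) (s := s) (w := w) le_rfl with
    ⟨x', hx', h⟩ | ⟨hn, u, x', hu, hx', hu', h⟩ | ⟨hn, h⟩
  · rw [congrFun (h _ le_rfl).2.2.2.2 x, Nat.sub_self]; exact hleaf _
  · rw [congrFun (h _ le_rfl).2.2.2.2 x]; exact hleaf _
  · rw [congrFun (h _ le_rfl).2.2.2.2 x]; exact h0 x

end RolloutStructure

/-! ### Measurability of the algorithm -/

section Measurability

/-- All discrete choices (actions, next states, sets of maximisers, choice rules) range over finite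
sets, so measurability may be checked with the choice held fixed. -/
theorem measurableSet_of_cases {α ι : Type*} [MeasurableSpace α] [Countable ι] {k : α → ι}
    (hk : ∀ i, MeasurableSet {a | k a = i}) {p : ι → α → Prop}
    (hp : ∀ i, MeasurableSet {a | p i a}) : MeasurableSet {a | p (k a) a} := by
  have : {a | p (k a) a} = ⋃ i, {a | k a = i} ∩ {a | p i a} := by ext a; simp
  rw [this]
  exact MeasurableSet.iUnion fun i => (hk i).inter (hp i)

theorem measurable_of_cases {α β ι : Type*} [MeasurableSpace α] [MeasurableSpace β] [Countable ι]
    {k : α → ι} (hk : ∀ i, MeasurableSet {a | k a = i}) {F : ι → α → β}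
    (hF : ∀ i, Measurable (F i)) : Measurable fun a => F (k a) a := fun B hB =>
  measurableSet_of_cases (p := fun i a => F i a ∈ B) hk fun i => hF i hB

theorem measurableSet_filter_eq {α A : Type*} [MeasurableSpace α] [Finite A] [DecidableEq A]
    (S U : Finset A) (p : α → A → Prop) [∀ q, DecidablePred (p q)]
    (hp : ∀ a, MeasurableSet {q | p q a}) : MeasurableSet {q | S.filter (p q) = U} := by
  simp only [Finset.ext_iff, Finset.mem_filter]
  rw [Set.ofPred_forall]
  refine MeasurableSet.iInter fun a => ?_
  have : MeasurableSet {q | a ∈ S ∧ p q a} := (MeasurableSet.const _).inter (hp a)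
  by_cases h' : a ∈ U <;> simp only [h', iff_true, iff_false]
  · exact this
  · exact this.compl

theorem measurableSet_argmaxOn_eq {α A : Type*} [MeasurableSpace α] [Finite A] [DecidableEq A]
    (S U : Finset A) {f : α → A → ℝ} (hf : ∀ a, Measurable fun q => f q a) :
    MeasurableSet {q | argmaxOn S (f q) = U} := by
  unfold argmaxOn
  refine measurableSet_filter_eq S U (fun q a => ∀ b ∈ S, f q b ≤ f q a) fun a => ?_
  simp only [Set.ofPred_forall]
  exact MeasurableSet.iInter fun b => MeasurableSet.iInter fun _ =>
    measurableSet_le (hf b) (hf a)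

theorem measurable_setAt {α X β : Type*} [MeasurableSpace α] [MeasurableSpace β] [DecidableEq X]
    {f : α → ℕ → X → β} (hf : Measurable f) (t : ℕ) (x : X) {v : α → β} (hv : Measurable v) :
    Measurable fun q => setAt (f q) t x (v q) := by
  refine measurable_pi_lambda _ fun t' => measurable_pi_lambda _ fun x' => ?_
  by_cases h : t' = t
  · subst h
    simp only [setAt_self]
    by_cases h' : x' = x
    · subst h'; simpa using hv
    · simp only [Function.update_of_ne h']; fun_prop
  · simp only [setAt_of_ne _ h]; fun_prop

theorem measurable_update_apply {α A β : Type*} [MeasurableSpace α] [MeasurableSpace β]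
    [DecidableEq A] {f : α → A → β} (hf : Measurable f) (a : A) {v : α → β} (hv : Measurable v) :
    Measurable fun q => Function.update (f q) a (v q) := by
  refine measurable_pi_lambda _ fun a' => ?_
  by_cases h : a' = a
  · subst h; simpa using hv
  · simp only [Function.update_of_ne h]; fun_prop

variable {X A : Type*}

instance : MeasurableSpace (Stats X A) :=
  MeasurableSpace.comap (fun s => (s.N, s.NA, s.Qbar, s.Vbar, s.Vhat)) inferInstance

theorem measurable_stats_iff {α : Type*} [MeasurableSpace α] {f : α → Stats X A} :
    Measurable f ↔ Measurable (fun q => (f q).N) ∧ Measurable (fun q => (f q).NA) ∧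
      Measurable (fun q => (f q).Qbar) ∧ Measurable (fun q => (f q).Vbar) ∧
      Measurable (fun q => (f q).Vhat) := by
  rw [measurable_comap_iff]
  constructor
  · intro h
    exact ⟨h.fst, h.snd.fst, h.snd.snd.fst, h.snd.snd.snd.fst, h.snd.snd.snd.snd⟩
  · rintro ⟨h1, h2, h3, h4, h5⟩
    exact h1.prodMk (h2.prodMk (h3.prodMk (h4.prodMk h5)))

@[fun_prop] theorem measurable_N : Measurable (Stats.N : Stats X A → _) :=
  (measurable_stats_iff.1 measurable_id).1
@[fun_prop] theorem measurable_NA : Measurable (Stats.NA : Stats X A → _) :=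
  (measurable_stats_iff.1 measurable_id).2.1
@[fun_prop] theorem measurable_Qbar : Measurable (Stats.Qbar : Stats X A → _) :=
  (measurable_stats_iff.1 measurable_id).2.2.1
@[fun_prop] theorem measurable_Vbar : Measurable (Stats.Vbar : Stats X A → _) :=
  (measurable_stats_iff.1 measurable_id).2.2.2.1
@[fun_prop] theorem measurable_Vhat : Measurable (Stats.Vhat : Stats X A → _) :=
  (measurable_stats_iff.1 measurable_id).2.2.2.2

variable [Fintype X] [DecidableEq X] [MeasurableSpace X] [MeasurableSingletonClass X]
  [Fintype A] [DecidableEq A] (G : Model X A) (P : Params X A) (x₀ : X)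

instance : Finite (ChoiceRule A) := by unfold ChoiceRule; infer_instance

instance : DiscreteMeasurableSpace (ChoiceRule A) := ⟨fun _ => trivial⟩

theorem measurableSet_unexpanded_eq (t : ℕ) (x : X) (U : Finset A) :
    MeasurableSet {s : Stats X A | unexpanded G P s t x = U} := by
  unfold unexpanded
  exact measurableSet_filter_eq _ U (fun (s : Stats X A) a => s.NA t x a < P.n₀) fun a =>
    measurableSet_lt (by fun_prop) measurable_const

theorem measurable_allocWeight {α : Type*} [MeasurableSpace α] (S : Finset A) (σ : A → ℝ)
    {δ : α → A → ℝ} (hδ : ∀ a, Measurable fun q => δ q a) (b a : A) :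
    Measurable fun q => allocWeight S σ (δ q) b a := by
  unfold allocWeight
  split_ifs
  · refine measurable_const.mul (Measurable.sqrt (Finset.measurable_sum _ fun c _ => ?_))
    exact (((measurable_const.div (hδ c)).pow_const 2).pow_const 2).div_const _
  · exact (measurable_const.div (hδ a)).pow_const 2

theorem measurableSet_ocbaSelect_eq (c : ChoiceRule A) (t : ℕ) (x : X) (a : A) :
    MeasurableSet {s : Stats X A | ocbaSelect G P s c t x = a} := by
  unfold ocbaSelect
  refine measurableSet_of_cases (k := fun s : Stats X A => argmaxOn (G.avail x) (s.Qbar t x))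
    (p := fun U s => c.1 (argmaxOn (G.avail x) fun a =>
      allocation (G.avail x) (fun a' => (P.sd t x a' : ℝ))
        (fun a => s.Qbar t x (c.1 U) - s.Qbar t x a) (c.1 U)
        (∑ a ∈ G.avail x, (s.NA t x a : ℝ) + 1) a - s.NA t x a) = a)
    (fun U => measurableSet_argmaxOn_eq _ U fun a => by fun_prop) fun U => ?_
  refine measurableSet_of_cases (p := fun U' _ => c.1 U' = a)
    (fun U' => measurableSet_argmaxOn_eq _ U' fun a => ?_) fun U' => MeasurableSet.const _
  have hw : ∀ a, Measurable fun s : Stats X A => allocWeight (G.avail x)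
      (fun a' => (P.sd t x a' : ℝ)) (fun a => s.Qbar t x (c.1 U) - s.Qbar t x a) (c.1 U) a :=
    fun a => measurable_allocWeight _ _ (fun a => by fun_prop) _ _
  have hN : ∀ a, Measurable fun s : Stats X A => (s.NA t x a : ℝ) := fun a =>
    measurable_from_top.comp (by fun_prop : Measurable fun s : Stats X A => s.NA t x a)
  unfold allocation
  refine Measurable.sub (Measurable.div (Measurable.mul ?_ (hw a))
    (Finset.measurable_sum _ fun a _ => hw a)) (hN a)
  exact (Finset.measurable_sum _ fun a _ => hN a).add_const 1

theorem measurableSet_act_eq (t : ℕ) (x : X) (a : A) :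
    MeasurableSet {q : Stats X A × ChoiceRule A | act G P q.1 q.2 t x = a} := by
  refine measurableSet_of_cases (k := fun q : Stats X A × ChoiceRule A => q.2)
    (p := fun c q => act G P q.1 c t x = a)
    (fun c => measurable_snd (measurableSet_singleton c)) fun c => ?_
  refine measurable_fst (t := {s | act G P s c t x = a}) ?_
  unfold act
  refine measurableSet_of_cases (k := fun s : Stats X A => unexpanded G P s t x)
    (p := fun U s => (if U.Nonempty then c.1 U else ocbaSelect G P s c t x) = a)
    (measurableSet_unexpanded_eq G P t x) fun U => ?_
  split_ifs
  · exact MeasurableSet.const _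
  · exact measurableSet_ocbaSelect_eq G P c t x a

theorem measurableSet_act_eq' (t : ℕ) (x : X) (a : A) :
    MeasurableSet {q : Stats X A × (ℕ → Noise X A) | act G P q.1 (q.2 t).2 t x = a} :=
  (by fun_prop : Measurable fun q : Stats X A × (ℕ → Noise X A) => (q.1, (q.2 t).2))
    (measurableSet_act_eq G P t x a)

theorem measurable_outcome (t : ℕ) (x : X) :
    Measurable fun q : Stats X A × (ℕ → Noise X A) => outcome G P q.1 q.2 t x :=
  measurable_of_cases (F := fun a q => (q.2 t).1 x a) (measurableSet_act_eq' G P t x)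
    fun a => by fun_prop

theorem measurable_simulate : ∀ k t x, Measurable fun w : ℕ → Noise X A => simulate G w k t x
  | 0, _, _ => measurable_const
  | k + 1, t, x => by
    have hz : Measurable fun w : ℕ → Noise X A => (w t).1 x ((w t).2.1 (G.avail x)) :=
      measurable_of_cases (k := fun w : ℕ → Noise X A => (w t).2)
        (F := fun c w => (w t).1 x (c.1 (G.avail x)))
        (fun c => (by fun_prop : Measurable fun w : ℕ → Noise X A => (w t).2)
          (measurableSet_singleton c)) fun c => by fun_prop
    exact hz.fst.add (measurable_of_cases (F := fun y w => simulate G w k (t + 1) y)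
      (fun y => hz.snd (measurableSet_singleton y)) (measurable_simulate k (t + 1)))

theorem measurable_natCast_comp {α : Type*} [MeasurableSpace α] {f : α → ℕ} (hf : Measurable f) :
    Measurable fun q => (f q : ℝ) := measurable_from_top.comp hf

theorem measurable_leafStats (t : ℕ) (y : X) :
    Measurable fun q : Stats X A × (ℕ → Noise X A) => leafStats G q.1 q.2 t y := by
  unfold leafStats leafUpdate
  have hr : Measurable fun q : Stats X A × (ℕ → Noise X A) =>
      simulate G q.2 (G.horizon - t) t y :=
    (measurable_simulate G (G.horizon - t) t y).comp measurable_snd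
  have hN : Measurable fun q : Stats X A × (ℕ → Noise X A) => q.1.N t y + 1 := by fun_prop
  have hN' := measurable_natCast_comp hN
  have hNA : Measurable fun q : Stats X A × (ℕ → Noise X A) => q.1.NA := by fun_prop
  have hQ : Measurable fun q : Stats X A × (ℕ → Noise X A) => q.1.Qbar := by fun_prop
  have hV : Measurable fun q : Stats X A × (ℕ → Noise X A) => q.1.Vbar := by fun_prop
  refine measurable_stats_iff.2 ⟨?_, hNA, hQ, hV, ?_⟩
  · exact measurable_setAt (by fun_prop) t y hN
  · refine measurable_setAt (by fun_prop) t y ?_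
    exact (((hN'.sub_const 1).div hN').mul (by fun_prop)).add ((measurable_const.div hN').mul hr)

theorem measurable_nodeUpdate {α : Type*} [MeasurableSpace α] (t : ℕ) (x : X) (a : A) (y : X)
    {r : α → ℝ} (hr : Measurable r) {s : α → Stats X A} (hs : Measurable s) :
    Measurable fun q => nodeUpdate G P ⟨t, x, a, r q, y⟩ (s q) := by
  have hn : Measurable fun q => (s q).N t x + 1 := by fun_prop
  have hm : Measurable fun q => (s q).NA t x a + 1 := by fun_prop
  have hn' := measurable_natCast_comp hn
  have hm' := measurable_natCast_comp hm
  have hα : Measurable fun q => P.α ((s q).N t x + 1) := measurable_from_top.comp hn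
  have hq : Measurable fun q => (((((s q).NA t x a + 1 : ℕ) : ℝ) - 1) /
      ((s q).NA t x a + 1 : ℕ) * (s q).Qbar t x a + 1 / ((s q).NA t x a + 1 : ℕ) *
        (r q + (s q).Vhat (t + 1) y)) := (((hm'.sub_const 1).div hm').mul
    (by fun_prop : Measurable fun q => (s q).Qbar t x a)).add ((measurable_const.div hm').mul
      (hr.add (by fun_prop : Measurable fun q => (s q).Vhat (t + 1) y)))
  have hrow := measurable_update_apply (by fun_prop : Measurable fun q => (s q).Qbar t x) a hq
  have hv : Measurable fun q => (((((s q).N t x + 1 : ℕ) : ℝ) - 1) /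
      ((s q).N t x + 1 : ℕ) * (s q).Vbar t x + 1 / ((s q).N t x + 1 : ℕ) *
      (((((s q).NA t x a + 1 : ℕ) : ℝ) - 1) /
      ((s q).NA t x a + 1 : ℕ) * (s q).Qbar t x a + 1 / ((s q).NA t x a + 1 : ℕ) *
        (r q + (s q).Vhat (t + 1) y))) := (((hn'.sub_const 1).div hn').mul
    (by fun_prop : Measurable fun q => (s q).Vbar t x)).add ((measurable_const.div hn').mul hq)
  refine measurable_stats_iff.2 ⟨?_, ?_, ?_, ?_, ?_⟩
  · exact measurable_setAt (by fun_prop) t x hn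
  · exact measurable_setAt (by fun_prop) t x (measurable_update_apply
      (by fun_prop : Measurable fun q => (s q).NA t x) a hm)
  · exact measurable_setAt (by fun_prop) t x hrow
  · exact measurable_setAt (by fun_prop) t x hv
  · refine measurable_setAt (by fun_prop) t x ?_
    refine ((measurable_const.sub hα).mul hv).add (hα.mul ?_)
    have := Finset.measurable_sup' (G.avail_nonempty x) (f := fun (a : A) (row : A → ℝ) => row a)
      fun a _ => measurable_pi_apply a
    convert this.comp hrow using 2
    simp [Finset.sup'_apply]

theorem measurable_descend : ∀ k t x,
    Measurable fun q : Stats X A × (ℕ → Noise X A) => descend G P q.1 q.2 k t x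
  | 0, t, x => measurable_leafStats G t x
  | k + 1, t, x => by
    have ho := measurable_outcome G P t x
    refine measurable_of_cases (F := fun a q => nodeUpdate G P
      ⟨t, x, a, (outcome G P q.1 q.2 t x).1, (outcome G P q.1 q.2 t x).2⟩
      (if (unexpanded G P q.1 t x).Nonempty then
        leafStats G q.1 q.2 (t + 1) (outcome G P q.1 q.2 t x).2
        else descend G P q.1 q.2 k (t + 1) (outcome G P q.1 q.2 t x).2))
      (measurableSet_act_eq' G P t x) fun a => ?_
    refine measurable_of_cases (F := fun y q => nodeUpdate G P
      ⟨t, x, a, (outcome G P q.1 q.2 t x).1, y⟩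
      (if (unexpanded G P q.1 t x).Nonempty then leafStats G q.1 q.2 (t + 1) y
        else descend G P q.1 q.2 k (t + 1) y))
      (fun y => ho.snd (measurableSet_singleton y)) fun y => ?_
    refine measurable_nodeUpdate G P t x a y ho.fst ?_
    refine measurable_of_cases (F := fun (U : Finset A) q => if U.Nonempty then
      leafStats G q.1 q.2 (t + 1) y else descend G P q.1 q.2 k (t + 1) y)
      (fun U => measurable_fst (measurableSet_unexpanded_eq G P t x U)) fun U => ?_
    split_ifs
    · exact measurable_leafStats G (t + 1) y
    · exact measurable_descend k (t + 1) y

theorem measurable_run : ∀ n, Measurable fun ω : ℕ → ℕ → Noise X A => run G P x₀ ω n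
  | 0 => measurable_const
  | n + 1 => by
    simp only [run, rollout_eq_descend]
    exact (measurable_descend G P G.horizon 0 x₀).comp
      (f := fun ω : ℕ → ℕ → Noise X A => (run G P x₀ ω n, ω n))
      ((measurable_run n).prodMk (by fun_prop))

theorem measurableSet_onPath : ∀ t x,
    MeasurableSet {q : Stats X A × (ℕ → Noise X A) | OnPath G P x₀ q.1 q.2 t x}
  | 0, _ => MeasurableSet.const _
  | t + 1, y => by
    simp only [OnPath, Set.ofPred_exists]
    refine MeasurableSet.iUnion fun x => (measurableSet_onPath t x).inter (MeasurableSet.inter ?_ ?_)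
    · exact measurableSet_of_cases (p := fun (U : Finset A) _ => ¬U.Nonempty)
        (fun U => measurable_fst (measurableSet_unexpanded_eq G P t x U)) fun U =>
          MeasurableSet.const _
    · exact (measurable_outcome G P t x).snd (measurableSet_singleton y)

/-- Rollout `n` takes action `a` at the node `(t, x)`. -/
def Takes (ω : ℕ → ℕ → Noise X A) (n t : ℕ) (x : X) (a : A) : Prop :=
  OnPath G P x₀ (run G P x₀ ω n) (ω n) t x ∧ act G P (run G P x₀ ω n) (ω n t).2 t x = a

theorem measurableSet_takes (n t : ℕ) (x : X) (a : A) :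
    MeasurableSet {ω | Takes G P x₀ ω n t x a} := by
  have hm : Measurable fun ω : ℕ → ℕ → Noise X A => (run G P x₀ ω n, ω n) :=
    (measurable_run G P x₀ n).prodMk (by fun_prop)
  exact (hm (measurableSet_onPath G P x₀ t x)).inter (hm (measurableSet_act_eq' G P t x a))

end Measurability

/-! ### What a redrawn outcome can and cannot influence -/

section Invariance

variable {X A : Type*} [DecidableEq X] [DecidableEq A] {G : Model X A} {P : Params X A} {x₀ : X}

theorem run_congr {ω ω' : ℕ → ℕ → Noise X A} :
    ∀ {n : ℕ}, (∀ i < n, ω i = ω' i) → run G P x₀ ω n = run G P x₀ ω' n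
  | 0, _ => rfl
  | n + 1, h => by
    rw [run, run, run_congr fun i hi => h i (by omega), h n (by omega)]

theorem onPath_congr {s : Stats X A} {w w' : ℕ → Noise X A} :
    ∀ {t : ℕ} {x : X}, (∀ u < t, w u = w' u) → (OnPath G P x₀ s w t x ↔ OnPath G P x₀ s w' t x)
  | 0, _, _ => Iff.rfl
  | t + 1, y, h => by
    have ih : ∀ x, OnPath G P x₀ s w t x ↔ OnPath G P x₀ s w' t x := fun x =>
      onPath_congr fun u hu => h u (by omega)
    simp only [OnPath, outcome, h t (by omega), ih]

theorem simulate_congr {w w' : ℕ → Noise X A} : ∀ {k t : ℕ} {x : X}, (∀ u ≥ t, w u = w' u) →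
    simulate G w k t x = simulate G w' k t x
  | 0, _, _, _ => rfl
  | k + 1, t, x, h => by
    simp only [simulate, h t le_rfl]
    rw [simulate_congr fun u hu => h u (by omega)]

theorem leafStats_congr {s : Stats X A} {w w' : ℕ → Noise X A} {t : ℕ} {y : X}
    (h : ∀ u ≥ t, w u = w' u) : leafStats G s w t y = leafStats G s w' t y := by
  rw [leafStats, leafStats, simulate_congr h]

theorem descend_congr {s : Stats X A} {w w' : ℕ → Noise X A} : ∀ {k t : ℕ} {x : X},
    (∀ u ≥ t, w u = w' u) → descend G P s w k t x = descend G P s w' k t x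
  | 0, _, _, h => leafStats_congr h
  | k + 1, t, x, h => by
    simp only [descend, outcome, h t le_rfl]
    rw [leafStats_congr fun u hu => h u (by omega), descend_congr fun u hu => h u (by omega)]

variable (G P) in
/-- The statistics after the part of a rollout that follows the step from `(t, x)` to `y`. -/
def tailStats (s : Stats X A) (w : ℕ → Noise X A) (t : ℕ) (x y : X) : Stats X A :=
  if (unexpanded G P s t x).Nonempty then leafStats G s w (t + 1) y
  else descend G P s w (G.horizon - (t + 1)) (t + 1) y

theorem tailStats_congr {s : Stats X A} {w w' : ℕ → Noise X A} {t : ℕ} {x y : X}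
    (h : ∀ u > t, w u = w' u) : tailStats G P s w t x y = tailStats G P s w' t x y := by
  rw [tailStats, tailStats, leafStats_congr h, descend_congr h]

/-- The backed-up value depends on the outcome at stage `t` only through the next state; otherwise
it uses old statistics and noise of later stages. -/
theorem Vhat_rollout_of_onPath {s : Stats X A} {w : ℕ → Noise X A} {t : ℕ} {x : X}
    (ht : t < G.horizon) (hx : OnPath G P x₀ s w t x) :
    (rollout G P x₀ s w).Vhat (t + 1) =
      (tailStats G P s w t x (outcome G P s w t x).2).Vhat (t + 1) := by
  rcases rollout_cases (G := G) (P := P) (x₀ := x₀) (s := s) (w := w) ht.le with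
    ⟨x', hx', h⟩ | ⟨hn, -⟩ | ⟨hn, -⟩
  · obtain rfl := hx.unique hx'
    obtain ⟨k, hk⟩ : ∃ k, G.horizon - t = k + 1 := ⟨G.horizon - t - 1, by omega⟩
    rw [hk, descend] at h
    rw [((h (t + 1) (by omega)).trans (rowsEq_nodeUpdate (by simp))).2.2.2.2, tailStats,
      show G.horizon - (t + 1) = k by omega]
  · exact absurd hx (hn x)
  · exact absurd hx (hn x)

variable [Fintype X] [MeasurableSpace X] [MeasurableSingletonClass X] [Fintype A]

theorem redraw_of_ne {n i : ℕ} (h : i ≠ n) (t : ℕ) (x : X) (a : A) (ω : ℕ → ℕ → Noise X A)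
    (z : ℝ × X) : redraw n t x a ω z i = ω i := by simp [redraw, h]

theorem redraw_stage_of_ne (n : ℕ) {t u : ℕ} (h : u ≠ t) (x : X) (a : A)
    (ω : ℕ → ℕ → Noise X A) (z : ℝ × X) : redraw n t x a ω z n u = ω n u := by simp [redraw, h]

theorem redraw_choice (n t : ℕ) (x : X) (a : A) (ω : ℕ → ℕ → Noise X A) (z : ℝ × X) :
    (redraw n t x a ω z n t).2 = (ω n t).2 := by simp [redraw]

theorem redraw_outcome (n t : ℕ) (x : X) (a : A) (ω : ℕ → ℕ → Noise X A) (z : ℝ × X) :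
    (redraw n t x a ω z n t).1 x a = z := by simp [redraw, setOutcome_self]

theorem run_redraw {n i : ℕ} (h : i ≤ n) (t : ℕ) (x : X) (a : A) (ω : ℕ → ℕ → Noise X A)
    (z : ℝ × X) : run G P x₀ (redraw n t x a ω z) i = run G P x₀ ω i :=
  run_congr fun j hj => redraw_of_ne (by omega) t x a ω z

/-- The decision rests on earlier rollouts, earlier stages and the choice rule of stage `t`, never
on the outcome of stage `t` in the same rollout. -/
theorem takes_redraw {n i : ℕ} (h : i ≤ n) (t : ℕ) (x : X) (a : A) (ω : ℕ → ℕ → Noise X A)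
    (z : ℝ × X) : Takes G P x₀ (redraw n t x a ω z) i t x a ↔ Takes G P x₀ ω i t x a := by
  rw [Takes, Takes, run_redraw h]
  rcases h.eq_or_lt with rfl | h
  · rw [redraw_choice, onPath_congr fun u hu => redraw_stage_of_ne i hu.ne x a ω z]
  · rw [redraw_of_ne h.ne]

theorem Takes.outcome_eq {ω : ℕ → ℕ → Noise X A} {n t : ℕ} {x : X} {a : A}
    (h : Takes G P x₀ ω n t x a) : outcome G P (run G P x₀ ω n) (ω n) t x = (ω n t).1 x a := by
  rw [outcome, h.2]

variable (D : Dynamics X A) (ν : Measure (ChoiceRule A)) [IsProbabilityMeasure ν]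

/-- Strong law of large numbers for the outcomes of an action at a node. -/
theorem ae_tendsto_average_outcomes (t : ℕ) (x : X) (a : A) {f : ℝ × X → ℝ} (hf : Measurable f)
    (hf2 : MemLp f 2 (D.law t x a)) :
    ∀ᵐ ω ∂(runLaw D ν),
      Tendsto (fun n => ∑ i ∈ Finset.range n,
        {ω | Takes G P x₀ ω i t x a}.indicator (1 : (ℕ → ℕ → Noise X A) → ℝ) ω) atTop atTop →
      Tendsto (fun n => (∑ i ∈ Finset.range n,
        {ω | Takes G P x₀ ω i t x a}.indicator (1 : (ℕ → ℕ → Noise X A) → ℝ) ω * f ((ω i t).1 x a)) /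
        ∑ i ∈ Finset.range n, {ω | Takes G P x₀ ω i t x a}.indicator (1 : (ℕ → ℕ → Noise X A) → ℝ) ω) atTop
        (𝓝 (∫ z, f z ∂(D.law t x a))) :=
  ae_tendsto_average_of_resampling (fun n => resampling_redraw D ν n t x a)
    (fun n => measurableSet_takes G P x₀ n t x a)
    (fun _ _ hi ω z => takes_redraw hi t x a ω z)
    (fun i n hi ω z => by rw [redraw_of_ne hi.ne]) hf hf2

/-- If the outcomes of an action have no atoms, then a new sample mean does not hit a given value. -/
theorem ae_Qbar_ne {t : ℕ} (ht : t < G.horizon) (x : X) (a : A)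
    (hatom : ∀ z, D.law t x a {z} = 0) (q : ℝ) :
    ∀ᵐ ω ∂(runLaw D ν), ∀ n, 0 < (run G P x₀ ω n).NA t x a → (run G P x₀ ω n).Qbar t x a ≠ q := by
  have hstep : ∀ n, ∀ᵐ ω ∂(runLaw D ν), ¬(Takes G P x₀ ω n t x a ∧
      (run G P x₀ ω (n + 1)).Qbar t x a = q) := fun n => by
    have hE : MeasurableSet {ω | Takes G P x₀ ω n t x a ∧
        (run G P x₀ ω (n + 1)).Qbar t x a = q} := by
      have hm := measurable_run G P x₀ (n + 1)
      exact (measurableSet_takes G P x₀ n t x a).inter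
        ((by fun_prop : Measurable fun ω => (run G P x₀ ω (n + 1)).Qbar t x a)
          (measurableSet_singleton q))
    rw [ae_iff]
    simp only [not_not]
    refine (resampling_redraw D ν n t x a).measure_eq_zero hE fun ω => ?_
    set s := run G P x₀ ω n with hs
    set m : ℝ := ((s.NA t x a + 1 : ℕ) : ℝ) with hm
    have hm0 : m ≠ 0 := by positivity
    -- Solve the update of the mean for the reward: with all other noise fixed, each next state `y`
    -- admits exactly one reward for which the new mean is `q`.
    set F : Set (ℝ × X) := Set.range fun y : X =>
      (m * (q - (m - 1) / m * s.Qbar t x a) - (tailStats G P s (ω n) t x y).Vhat (t + 1) y, y)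
    refine measure_mono_null (t := F) ?_ ?_
    · rintro z ⟨hz, hq⟩
      have hs' : run G P x₀ (redraw n t x a ω z) n = s := run_redraw le_rfl t x a ω z
      have ho := hz.outcome_eq
      obtain ⟨hp, ha⟩ := hz
      rw [hs'] at hp ha ho
      rw [redraw_outcome] at ho
      have h3 := (rollout_of_onPath ht hp).2.2.1
      simp only [ha] at h3
      rw [Vhat_rollout_of_onPath ht hp, ho,
        tailStats_congr (w' := ω n) fun u hu => redraw_stage_of_ne n (by omega) x a ω z] at h3
      rw [run, hs', h3, Function.update_self] at hq
      refine ⟨z.2, Prod.ext ?_ rfl⟩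
      simp only
      rw [← hq, ← hm]
      field_simp
      ring
    · have hF : F.Countable := Set.countable_range _
      rw [← Set.biUnion_of_singleton F]
      exact (measure_biUnion_null_iff hF).2 fun z _ => hatom z
  filter_upwards [ae_all_iff.2 hstep] with ω hω n
  induction n with
  | zero => intro h; simp [run, Stats.init] at h
  | succ n ih =>
    intro hN
    by_cases hp : OnPath G P x₀ (run G P x₀ ω n) (ω n) t x
    · by_cases ha : act G P (run G P x₀ ω n) (ω n t).2 t x = a
      · exact fun h => hω n ⟨⟨hp, ha⟩, h⟩
      · have h := rollout_of_onPath ht hp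
        simp only at h
        rw [run, h.2.1, Function.update_of_ne (Ne.symm ha)] at hN
        rw [run, h.2.2.1, Function.update_of_ne (Ne.symm ha)]
        exact ih hN
    · have h := rollout_of_not_onPath ht hp
      simp only at h
      rw [run, h.2.1] at hN
      rw [run, h.2.2.1]
      exact ih hN

end Invariance

/-! ### OCBA starves no action -/

section AllocationLimit

variable {A : Type*} [DecidableEq A] {S : Finset A} {σ : A → ℝ}

theorem argmaxOn_nonempty (hS : S.Nonempty) (f : A → ℝ) : (argmaxOn S f).Nonempty := by
  obtain ⟨a, ha, h⟩ := S.exists_max_image f hS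
  exact ⟨a, Finset.mem_filter.2 ⟨ha, h⟩⟩

theorem mem_argmaxOn {f : A → ℝ} {a : A} : a ∈ argmaxOn S f ↔ a ∈ S ∧ ∀ b ∈ S, f b ≤ f a :=
  Finset.mem_filter

theorem allocWeight_nonneg (hσ : ∀ a, 0 < σ a) (δ : A → ℝ) (b a : A) :
    0 ≤ allocWeight S σ δ b a := by
  unfold allocWeight
  split_ifs
  · exact mul_nonneg (hσ b).le (Real.sqrt_nonneg _)
  · exact sq_nonneg _

theorem allocation_nonneg (hσ : ∀ a, 0 < σ a) (δ : A → ℝ) (b a : A) {T : ℝ} (hT : 0 ≤ T) :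
    0 ≤ allocation S σ δ b T a :=
  div_nonneg (mul_nonneg hT (allocWeight_nonneg hσ δ b a))
    (Finset.sum_nonneg fun c _ => allocWeight_nonneg hσ δ b c)

/-- With two actions, the action `a` gets at most the share `σ a / (σ a + σ f)` of the budget. -/
theorem allocation_pair_le (hσ : ∀ a, 0 < σ a) {a f : A} (haf : a ≠ f) (δ : A → ℝ) {b : A}
    (hb : b = a ∨ b = f) {T : ℝ} (hT : 0 ≤ T) :
    allocation {a, f} σ δ b T a ≤ σ a / (σ a + σ f) * T := by
  -- With a single rival the weights are in the ratio `σ a : σ f`, whichever action is sample-best;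
  -- the gap sits in the common factor `c`.
  obtain ⟨c, hca, hcf⟩ : ∃ c : ℝ, allocWeight {a, f} σ δ b a = σ a * c ∧
      allocWeight {a, f} σ δ b f = σ f * c := by
    have key : ∀ v : A, √(((σ v / δ v) ^ 2) ^ 2 / σ v ^ 2) = σ v / δ v ^ 2 := fun v => by
      have h := (hσ v).ne'
      have : ((σ v / δ v) ^ 2) ^ 2 / σ v ^ 2 = (σ v / δ v ^ 2) ^ 2 := by
        by_cases hd : δ v = 0
        · simp [hd]
        · field_simp
      rw [this, Real.sqrt_sq (div_nonneg (hσ v).le (sq_nonneg _))]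
    rcases hb with rfl | rfl
    · refine ⟨σ f / δ f ^ 2, ?_, ?_⟩
      · have : ({b, f} : Finset A).erase b = {f} := by
          ext y; simp only [Finset.mem_erase, Finset.mem_insert, Finset.mem_singleton]
          constructor
          · tauto
          · rintro rfl; exact ⟨haf.symm, Or.inr rfl⟩
        simp [allocWeight, this, key f]
      · simp [allocWeight, haf.symm, div_pow]; ring
    · refine ⟨σ a / δ a ^ 2, ?_, ?_⟩
      · simp [allocWeight, haf, div_pow]; ring
      · have : ({a, b} : Finset A).erase b = {a} := by
          ext y; simp only [Finset.mem_erase, Finset.mem_insert, Finset.mem_singleton]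
          constructor
          · tauto
          · rintro rfl; exact ⟨haf, Or.inl rfl⟩
        simp [allocWeight, this, key a]
  have h1 := hσ a
  have h2 := hσ f
  rw [allocation, Finset.sum_pair haf, hca, hcf]
  -- In a tie both weights vanish and the allocation is `0 / 0 = 0`, which satisfies the bound.
  by_cases hc : c = 0
  · simp only [hc, mul_zero, zero_div]; positivity
  · refine le_of_eq ?_
    field_simp

variable {q : ℕ → A → ℝ} {N : ℕ → A → ℕ} {V : ℕ → Prop} {act : ℕ → A}

theorem tendsto_atTop_of_frequently_lt {f : ℕ → ℕ} (hf : Monotone f)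
    (h : ∃ᶠ n in atTop, f n < f (n + 1)) : Tendsto f atTop atTop := by
  refine tendsto_atTop_atTop_of_monotone hf fun k => ?_
  induction k with
  | zero => exact ⟨0, Nat.zero_le _⟩
  | succ k ih =>
    obtain ⟨m, hm⟩ := ih
    obtain ⟨n, hn, hlt⟩ := h.forall_exists_of_atTop m
    exact ⟨n + 1, by have := hf hn; omega⟩

theorem sum_count_tendsto
    (hNV : ∀ n, V n → N (n + 1) = Function.update (N n) (act n) (N n (act n) + 1))
    (hNn : ∀ n, ¬V n → N (n + 1) = N n) (hV : ∃ᶠ n in atTop, V n)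
    (hS : ∀ᶠ n in atTop, V n → act n ∈ S) :
    Tendsto (fun n => ∑ a ∈ S, N n a) atTop atTop := by
  have hmono : Monotone fun n => ∑ a ∈ S, N n a := by
    refine monotone_nat_of_le_succ fun n => Finset.sum_le_sum fun a _ => ?_
    by_cases h : V n
    · rw [hNV n h]
      by_cases ha : a = act n
      · subst ha; simp
      · simp [ha]
    · rw [hNn n h]
  refine tendsto_atTop_of_frequently_lt hmono ((hV.and_eventually hS).mono fun n ⟨hVn, hSn⟩ => ?_)
  have hSn := hSn hVn
  have : ∑ a ∈ S, N (n + 1) a = ∑ a ∈ S, N n a + 1 := by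
    rw [hNV n hVn, ← Finset.add_sum_erase S _ hSn, ← Finset.add_sum_erase S (N n) hSn,
      Function.update_self, Finset.sum_congr rfl fun a ha =>
        Function.update_of_ne (Finset.ne_of_mem_erase ha) _ _]
    ring
  omega

/-- If the actions that are taken from some time on are always allotted a share of the budget that
is bounded away from one, then another action would have been starving. -/
theorem false_of_allocation_le {al : ℕ → A → ℝ} {I : Finset A} {p : A → ℝ}
    (hNV : ∀ n, V n → N (n + 1) = Function.update (N n) (act n) (N n (act n) + 1))
    (hNn : ∀ n, ¬V n → N (n + 1) = N n) (hV : ∃ᶠ n in atTop, V n) (hIS : I ⊆ S) {f : A}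
    (hf : f ∈ S) (hfI : f ∉ I) (hal0 : ∀ n, 0 ≤ al n f)
    (hact : ∀ᶠ n in atTop, V n → act n ∈ argmaxOn S fun a => al n a - N n a)
    (hI : ∀ᶠ n in atTop, V n → act n ∈ I) (hp0 : ∀ a ∈ I, 0 ≤ p a) (hp1 : ∑ a ∈ I, p a < 1)
    (hp : ∀ᶠ n in atTop, V n → ∀ a ∈ I, al n a ≤ p a * (∑ c ∈ S, (N n c : ℝ) + 1)) : False := by
  obtain ⟨n₁, hn₁⟩ := eventually_atTop.1 (hact.and (hI.and hp))
  have hT := sum_count_tendsto hNV hNn hV (hI.mono fun n h hv => hIS (h hv))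
  set C : ℝ := ∑ c ∈ S, (N n₁ c : ℝ) + 1 with hC
  have hC0 : 0 ≤ C := by positivity
  have hle : ∀ a ∈ S, (N n₁ a : ℝ) + 1 ≤ C := fun a ha => by
    have := Finset.single_le_sum (f := fun c => (N n₁ c : ℝ)) (fun c _ => Nat.cast_nonneg _) ha
    linarith
  have hconst : ∀ n ≥ n₁, ∀ a ∉ I, N n a = N n₁ a := fun n hn a ha => by
    induction n, hn using Nat.le_induction with
    | base => rfl
    | succ n hn ih =>
      by_cases hv : V n
      · rw [hNV n hv, Function.update_of_ne, ih]
        rintro rfl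
        exact ha ((hn₁ n hn).2.1 hv)
      · rw [hNn n hv, ih]
  have hmono : ∀ n a, N n a ≤ N (n + 1) a := fun n a => by
    by_cases h : V n
    · rw [hNV n h]
      by_cases ha : a = act n
      · subst ha; simp
      · simp [ha]
    · rw [hNn n h]
  have hTm : ∀ n, ∑ c ∈ S, (N n c : ℝ) + 1 ≤ ∑ c ∈ S, (N (n + 1) c : ℝ) + 1 := fun n => by
    gcongr with c; exact hmono n c
  -- When `a` is chosen, its deficit is at least that of `f`, hence at least minus the frozen count
  -- of `f`. So the count of `a` exceeds its allotment by at most that count, and `C` leaves room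
  -- for the new sample.
  have hbound : ∀ n ≥ n₁, ∀ a ∈ I, (N n a : ℝ) ≤ p a * (∑ c ∈ S, (N n c : ℝ) + 1) + C := by
    intro n hn a ha
    induction n, hn using Nat.le_induction with
    | base =>
      have := hle a (hIS ha)
      have : 0 ≤ p a * (∑ c ∈ S, (N n₁ c : ℝ) + 1) := mul_nonneg (hp0 a ha) (by positivity)
      linarith
    | succ n hn ih =>
      have hstep := mul_le_mul_of_nonneg_left (hTm n) (hp0 a ha)
      by_cases hv : V n
      · by_cases hact : a = act n
        · have h1 := (mem_argmaxOn.1 ((hn₁ n hn).1 hv)).2 f hf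
          have h2 := (hn₁ n hn).2.2 hv a ha
          rw [← hact, hconst n hn f hfI] at h1
          have h3 := hle f hf
          have h4 := hal0 n
          rw [show (N (n + 1) a : ℝ) = N n a + 1 by rw [hNV n hv, hact]; simp]
          linarith
        · rw [show N (n + 1) a = N n a by rw [hNV n hv, Function.update_of_ne hact]]
          linarith
      · rw [show N (n + 1) a = N n a by rw [hNn n hv]]
        linarith
  -- Excess of the actions in `I`, frozen counts outside `I`, and one for the extra unit of budget:
  -- a total beyond this threshold contradicts the sum of the bounds.
  obtain ⟨B, hB⟩ := exists_nat_gt ((I.card * C + C + 1) / (1 - ∑ a ∈ I, p a))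
  obtain ⟨n, hn, hnB⟩ := ((hT.eventually_ge_atTop B).and (eventually_ge_atTop n₁)).exists
  have hnB' : (B : ℝ) ≤ ∑ c ∈ S, (N n c : ℝ) := by exact_mod_cast hn
  have hpos : 0 < 1 - ∑ a ∈ I, p a := by linarith
  rw [div_lt_iff₀ hpos] at hB
  have hsum : ∑ c ∈ S, (N n c : ℝ) = ∑ c ∈ I, (N n c : ℝ) + ∑ c ∈ S \ I, (N n c : ℝ) := by
    rw [add_comm, Finset.sum_sdiff hIS]
  have h1 : ∑ c ∈ I, (N n c : ℝ) ≤
      (∑ a ∈ I, p a) * (∑ c ∈ S, (N n c : ℝ) + 1) + I.card * C := by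
    refine (Finset.sum_le_sum fun a ha => hbound n hnB a ha).trans (le_of_eq ?_)
    rw [Finset.sum_add_distrib, ← Finset.sum_mul]; simp
  have h2 : ∑ c ∈ S \ I, (N n c : ℝ) ≤ C := by
    rw [Finset.sum_congr rfl fun c hc => by rw [hconst n hnB c (Finset.mem_sdiff.1 hc).2]]
    have := Finset.sum_le_sum_of_subset_of_nonneg (f := fun c => (N n₁ c : ℝ))
      (Finset.sdiff_subset (s := S) (t := I)) fun c _ _ => Nat.cast_nonneg _
    linarith
  nlinarith [mul_le_mul_of_nonneg_right hnB' hpos.le]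

/-- Limiting shares of the OCBA allocation: `I` is the set of actions whose sample means converge,
while the other sample means are eventually constant. -/
theorem exists_share_of_tendsto (hσ : ∀ a, 0 < σ a) {L : A → ℝ} {I : Finset A} (hIS : I ⊆ S)
    (hI : I.Nonempty) {f : A} (hf : f ∈ S) (hfI : f ∉ I)
    (hlim : ∀ a ∈ I, Tendsto (fun n => q n a) atTop (𝓝 (L a)))
    (hfro : ∀ a ∈ S, a ∉ I → ∀ᶠ n in atTop, q n a = L a)
    (hdist : ∀ a ∈ I, ∀ c ∈ S, c ≠ a → L a ≠ L c) :
    ∃ p : A → ℝ, (∀ a ∈ I, 0 ≤ p a) ∧ ∑ a ∈ I, p a < 1 ∧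
      ∀ᶠ n in atTop, ∀ b ∈ argmaxOn S (q n), ∀ a ∈ I, ∀ T : ℝ, 0 ≤ T →
        allocation S σ (fun a => q n b - q n a) b T a ≤ p a * T := by
  have hlim' : ∀ a ∈ S, Tendsto (fun n => q n a) atTop (𝓝 (L a)) := fun a ha => by
    by_cases h : a ∈ I
    · exact hlim a h
    · exact tendsto_const_nhds.congr' ((hfro a ha h).mono fun n hn => hn.symm)
  set M := argmaxOn S L with hM
  -- If frozen actions tie for the best mean, the sample-best one may vary with tie-breaking. The
  -- smallest `σ` gives the least weight to the best action, hence the largest shares to `I`.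
  obtain ⟨b₀, hb₀, hmin⟩ := M.exists_min_image σ (argmaxOn_nonempty ⟨f, hf⟩ L)
  have hMeq : ∀ b ∈ M, L b = L b₀ := fun b hb =>
    le_antisymm ((mem_argmaxOn.1 hb₀).2 b (mem_argmaxOn.1 hb).1)
      ((mem_argmaxOn.1 hb).2 b₀ (mem_argmaxOn.1 hb₀).1)
  have hMS : ∀ b ∈ M, b ∈ S := fun b hb => (mem_argmaxOn.1 hb).1
  have hnM : ∀ a ∈ S, a ∉ M → L a < L b₀ := fun a ha h => by
    refine lt_of_le_of_ne ((mem_argmaxOn.1 hb₀).2 a ha) fun e => h ?_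
    exact mem_argmaxOn.2 ⟨ha, fun c hc => e ▸ (mem_argmaxOn.1 hb₀).2 c hc⟩
  have hMI : ∀ b ∈ M, ∀ c ∈ M, b ≠ c → b ∉ I := fun b hb c hc h hbI =>
    hdist b hbI c (hMS c hc) h.symm ((hMeq b hb).trans (hMeq c hc).symm)
  set r : A → ℝ := fun a => (σ a / (L b₀ - L a)) ^ 2 with hr
  have hr0 : ∀ a, 0 ≤ r a := fun a => sq_nonneg _
  have hrM : ∀ b ∈ M, r b = 0 := fun b hb => by simp [hr, hMeq b hb]
  have hrpos : ∀ a ∈ S, a ∉ M → 0 < r a := fun a ha h => by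
    have h1 := hnM a ha h
    have h2 := hσ a
    have : 0 < σ a / (L b₀ - L a) := div_pos h2 (by linarith)
    positivity
  -- Not all limits coincide, since `I` contains an action and `f` lies outside it. This keeps the
  -- limiting weights from degenerating.
  obtain ⟨e, heS, heM⟩ : ∃ e ∈ S, e ∉ M := by
    by_contra! h
    obtain ⟨a, ha⟩ := hI
    exact hMI a (h a (hIS ha)) f (h f hf) (fun e => hfI (e ▸ ha)) ha
  set s : ℝ := √(∑ c ∈ S, r c ^ 2 / σ c ^ 2) with hs
  have hs0 : 0 < s := by
    refine Real.sqrt_pos.2 (Finset.sum_pos' (fun c _ => by positivity) ⟨e, heS, ?_⟩)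
    have := hrpos e heS heM
    have := hσ e
    positivity
  have hR : 0 < ∑ c ∈ S, r c := Finset.sum_pos' (fun c _ => hr0 c) ⟨e, heS, hrpos e heS heM⟩
  set wt : A → A → ℝ := fun b a => if a = b then σ b * s else r a with hwt
  have hwt0 : ∀ b a, 0 ≤ wt b a := fun b a => by
    simp only [hwt]; split_ifs
    · exact mul_nonneg (hσ b).le hs0.le
    · exact hr0 a
  have hW : ∀ b ∈ M, ∑ c ∈ S, wt b c = σ b * s + ∑ c ∈ S, r c := fun b hb => by
    rw [← Finset.add_sum_erase S _ (hMS b hb), ← Finset.add_sum_erase S r (hMS b hb), hrM b hb,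
      zero_add]
    congr 1
    · simp [hwt]
    · exact Finset.sum_congr rfl fun c hc => by simp [hwt, Finset.ne_of_mem_erase hc]
  have hWpos : ∀ b ∈ M, 0 < ∑ c ∈ S, wt b c := fun b hb => by
    rw [hW b hb]; have := mul_pos (hσ b) hs0; linarith
  set p₀ : A → ℝ := fun a => wt b₀ a / ∑ c ∈ S, wt b₀ c with hp₀
  have hp₀0 : ∀ a, 0 ≤ p₀ a := fun a => div_nonneg (hwt0 _ _) (hWpos b₀ hb₀).le
  have hsum : ∑ a ∈ I, p₀ a < 1 := by
    have h1 : ∑ a ∈ S, p₀ a = 1 := by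
      rw [← Finset.sum_div, div_self (hWpos b₀ hb₀).ne']
    rw [← h1]
    -- Some action outside `I` keeps a positive limiting share: `b₀` itself, or, if `b₀` is in `I`,
    -- the starved `f`, whose limit is then strictly below the best.
    have hex : ∃ g ∈ S, g ∉ I ∧ 0 < wt b₀ g := by
      by_cases h : b₀ ∈ I
      · have hne : f ≠ b₀ := fun e => hfI (e ▸ h)
        refine ⟨f, hf, hfI, ?_⟩
        simp only [hwt, hne, if_false]
        exact hrpos f hf fun hfM => hMI b₀ hb₀ f hfM hne.symm h
      · refine ⟨b₀, hMS b₀ hb₀, h, ?_⟩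
        simp only [hwt, if_true]
        exact mul_pos (hσ b₀) hs0
    obtain ⟨g, hgS, hgI, hg⟩ := hex
    exact Finset.sum_lt_sum_of_subset hIS hgS hgI (div_pos hg (hWpos b₀ hb₀)) fun c _ _ => hp₀0 c
  have hratio : ∀ b ∈ M, ∀ a ∈ I, wt b a / ∑ c ∈ S, wt b c ≤ p₀ a := fun b hb a ha => by
    by_cases h : b = b₀
    · rw [h]
    · have h1 : a ≠ b := fun e => hMI b hb b₀ hb₀ h (e ▸ ha)
      have h2 : a ≠ b₀ := fun e => hMI b₀ hb₀ b hb (Ne.symm h) (e ▸ ha)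
      have h3 := hWpos b₀ hb₀
      simp only [hp₀]
      rw [hW b hb] at *
      rw [hW b₀ hb₀] at *
      simp only [hwt, h1, h2, if_false]
      refine div_le_div_of_nonneg_left (hr0 a) h3 ?_
      have := mul_le_mul_of_nonneg_right (hmin b hb) hs0.le
      linarith
  have hrlim : ∀ b ∈ M, ∀ a ∈ S, a ≠ b →
      Tendsto (fun n => (σ a / (q n b - q n a)) ^ 2) atTop (𝓝 (r a)) := fun b hb a ha hab => by
    -- Two distinct maximisers are both frozen, so their gap is eventually exactly zero and division
    -- by zero gives the weight zero, in agreement with `r`.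
    by_cases haM : a ∈ M
    · rw [hrM a haM]
      refine tendsto_const_nhds.congr' ?_
      filter_upwards [hfro a ha (hMI a haM b hb hab), hfro b (hMS b hb) (hMI b hb a haM hab.symm)]
        with n h1 h2
      simp [h1, h2, hMeq a haM, hMeq b hb]
    · have h1 := hnM a ha haM
      rw [← hMeq b hb] at h1
      simp only [hr, ← hMeq b hb]
      exact ((tendsto_const_nhds.div ((hlim' b (hMS b hb)).sub (hlim' a ha))
        (by linarith)).pow 2)
  have hwlim : ∀ b ∈ M, ∀ a ∈ S,
      Tendsto (fun n => allocWeight S σ (fun a => q n b - q n a) b a) atTop (𝓝 (wt b a)) := by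
    intro b hb a ha
    by_cases hab : a = b
    · simp only [allocWeight, hwt, hab, if_true]
      refine tendsto_const_nhds.mul (Tendsto.sqrt ?_)
      rw [← Finset.add_sum_erase S _ (hMS b hb), hrM b hb]
      simp only [ne_eq, OfNat.ofNat_ne_zero, not_false_eq_true, zero_pow, zero_div, zero_add]
      exact tendsto_finsetSum _ fun c hc => ((hrlim b hb c (Finset.mem_of_mem_erase hc)
        (Finset.ne_of_mem_erase hc)).pow 2).div_const _
    · simp only [allocWeight, hwt, hab, if_false]
      exact hrlim b hb a ha hab
  have hI0 : (0 : ℝ) < I.card := by exact_mod_cast hI.card_pos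
  -- Half of the missing mass, shared equally, is the room for passing from limiting shares to
  -- eventual bounds.
  set ε : ℝ := (1 - ∑ a ∈ I, p₀ a) / (2 * I.card) with hε
  have hε0 : 0 < ε := div_pos (by linarith) (by positivity)
  refine ⟨fun a => p₀ a + ε, fun a _ => by have := hp₀0 a; linarith, ?_, ?_⟩
  · rw [Finset.sum_add_distrib, Finset.sum_const, nsmul_eq_mul, hε]
    have : (I.card : ℝ) * ((1 - ∑ a ∈ I, p₀ a) / (2 * I.card)) = (1 - ∑ a ∈ I, p₀ a) / 2 := by
      field_simp
    linarith
  · have h1 : ∀ᶠ n in atTop, ∀ a ∈ S, a ∉ M → q n a < q n b₀ := by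
      refine (Filter.eventually_all_finset S).2 fun a ha => ?_
      by_cases h : a ∈ M
      · exact Eventually.of_forall fun n h' => absurd h h'
      · exact ((hlim' a ha).eventually_lt (hlim' b₀ (hMS b₀ hb₀)) (hnM a ha h)).mono
          fun n hn _ => hn
    have h2 : ∀ᶠ n in atTop, ∀ b ∈ M, ∀ a ∈ I,
        allocWeight S σ (fun a => q n b - q n a) b a /
          ∑ c ∈ S, allocWeight S σ (fun a => q n b - q n a) b c ≤ p₀ a + ε := by
      refine (Filter.eventually_all_finset M).2 fun b hb =>
        (Filter.eventually_all_finset I).2 fun a ha => ?_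
      have := (hwlim b hb a (hIS ha)).div (tendsto_finsetSum S fun c hc => hwlim b hb c hc)
        (hWpos b hb).ne'
      refine (this.eventually_lt_const (u := p₀ a + ε) ?_).mono fun n hn => hn.le
      have := hratio b hb a ha
      linarith
    filter_upwards [h1, h2] with n hn1 hn2 b hb a ha T hT
    have hbM : b ∈ M := by
      by_contra h
      have hb' := mem_argmaxOn.1 hb
      exact absurd (hb'.2 b₀ (hMS b₀ hb₀)) (not_le.2 (hn1 b hb'.1 h))
    rw [allocation, mul_div_assoc, mul_comm T]
    exact mul_le_mul_of_nonneg_right (hn2 b hbM a ha) hT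

/-- OCBA selection takes every action infinitely often. -/
theorem forall_frequently_of_ocba (hσ : ∀ a, 0 < σ a)
    (hNV : ∀ n, V n → N (n + 1) = Function.update (N n) (act n) (N n (act n) + 1))
    (hNn : ∀ n, ¬V n → N (n + 1) = N n) (hV : ∃ᶠ n in atTop, V n)
    (hact : ∀ᶠ n in atTop, V n → ∃ b ∈ argmaxOn S (q n), act n ∈ argmaxOn S fun a =>
      allocation S σ (fun a => q n b - q n a) b (∑ c ∈ S, (N n c : ℝ) + 1) a - N n a)
    {L : A → ℝ}
    (hlim : ∀ a ∈ S, (∃ᶠ n in atTop, V n ∧ act n = a) → Tendsto (fun n => q n a) atTop (𝓝 (L a)))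
    (hfro : ∀ a ∈ S, ¬(∃ᶠ n in atTop, V n ∧ act n = a) → ∀ᶠ n in atTop, q n a = L a)
    (hdist : 3 ≤ S.card → ∀ a ∈ S, (∃ᶠ n in atTop, V n ∧ act n = a) → ∀ c ∈ S, c ≠ a →
      L a ≠ L c) :
    ∀ a ∈ S, ∃ᶠ n in atTop, V n ∧ act n = a := by
  classical
  by_contra! hcon
  obtain ⟨f, hf, hfI⟩ := hcon
  set I : Finset A := S.filter fun a => ∃ᶠ n in atTop, V n ∧ act n = a with hIdef
  have hIS : I ⊆ S := Finset.filter_subset _ _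
  have hmemI : ∀ a, a ∈ I ↔ a ∈ S ∧ ∃ᶠ n in atTop, V n ∧ act n = a := fun a => Finset.mem_filter
  have hfI' : f ∉ I := fun h => ((hmemI f).1 h).2 (by simpa using hfI)
  have hIev : ∀ᶠ n in atTop, V n → act n ∈ I := by
    have : ∀ᶠ n in atTop, ∀ a ∈ S, a ∉ I → ¬(V n ∧ act n = a) := by
      refine (Filter.eventually_all_finset S).2 fun a ha => ?_
      by_cases h : a ∈ I
      · exact Eventually.of_forall fun n h' => absurd h h'
      · have h' : ¬∃ᶠ n in atTop, V n ∧ act n = a := fun h' => h ((hmemI a).2 ⟨ha, h'⟩)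
        exact (not_frequently.1 h').mono fun n hn _ => hn
    filter_upwards [this, hact] with n hn ha hv
    obtain ⟨b, -, hb⟩ := ha hv
    by_contra h
    exact hn _ (mem_argmaxOn.1 hb).1 h ⟨hv, rfl⟩
  have hIne : I.Nonempty := by
    obtain ⟨n, hn, h⟩ := (hV.and_eventually hIev).exists
    exact ⟨_, h hn⟩
  have hT0 : ∀ n, 0 ≤ ∑ c ∈ S, (N n c : ℝ) + 1 := fun n => by positivity
  have hshare : ∃ p : A → ℝ, (∀ a ∈ I, 0 ≤ p a) ∧ ∑ a ∈ I, p a < 1 ∧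
      ∀ᶠ n in atTop, ∀ b ∈ argmaxOn S (q n), ∀ a ∈ I, ∀ T : ℝ, 0 ≤ T →
        allocation S σ (fun a => q n b - q n a) b T a ≤ p a * T := by
    -- Otherwise an action in `I` and the starved `f` make up all of `S`, and the explicit
    -- two-action share needs neither limits nor distinct means.
    by_cases hcard : 3 ≤ S.card
    · exact exists_share_of_tendsto hσ hIS hIne hf hfI'
        (fun a ha => hlim a (hIS ha) ((hmemI a).1 ha).2)
        (fun a ha h => hfro a ha fun h' => h ((hmemI a).2 ⟨ha, h'⟩))
        (fun a ha c hc => hdist hcard a (hIS ha) ((hmemI a).1 ha).2 c hc)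
    · obtain ⟨a, ha⟩ := hIne
      have haf : a ≠ f := fun e => hfI' (e ▸ ha)
      have hsub : ({a, f} : Finset A) ⊆ S := by
        intro y hy
        rcases Finset.mem_insert.1 hy with rfl | hy
        · exact hIS ha
        · rwa [Finset.mem_singleton.1 hy]
      have hSeq : S = {a, f} := (Finset.eq_of_subset_of_card_le hsub (by
        rw [Finset.card_pair haf]; omega)).symm
      have hIeq : I = {a} := by
        ext y
        rw [Finset.mem_singleton]
        refine ⟨fun hy => ?_, fun hy => hy ▸ ha⟩
        have := hIS hy
        rw [hSeq, Finset.mem_insert, Finset.mem_singleton] at this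
        exact this.resolve_right fun e => hfI' (e ▸ hy)
      have h1 := hσ a
      have h2 := hσ f
      refine ⟨fun _ => σ a / (σ a + σ f), fun _ _ => by positivity, ?_,
        Eventually.of_forall fun n b hb c hc T hT => ?_⟩
      · rw [hIeq, Finset.sum_singleton, div_lt_one (by positivity)]; linarith
      · rw [hIeq, Finset.mem_singleton] at hc
        subst hc
        have hb' := (mem_argmaxOn.1 hb).1
        rw [hSeq, Finset.mem_insert, Finset.mem_singleton] at hb'
        rw [hSeq]
        exact allocation_pair_le hσ haf _ hb' hT
  obtain ⟨p, hp0, hp1, hp⟩ := hshare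
  have hb : ∀ n, ∃ b : A, (V n ∧ ∃ b ∈ argmaxOn S (q n),
      act n ∈ argmaxOn S fun a => allocation S σ (fun a => q n b - q n a) b
        (∑ c ∈ S, (N n c : ℝ) + 1) a - N n a) → b ∈ argmaxOn S (q n) ∧
      act n ∈ argmaxOn S fun a => allocation S σ (fun a => q n b - q n a) b
        (∑ c ∈ S, (N n c : ℝ) + 1) a - N n a := fun n => by
    by_cases h : ∃ b ∈ argmaxOn S (q n),
      act n ∈ argmaxOn S fun a => allocation S σ (fun a => q n b - q n a) b
        (∑ c ∈ S, (N n c : ℝ) + 1) a - N n a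
    · obtain ⟨b, h1, h2⟩ := h
      exact ⟨b, fun _ => ⟨h1, h2⟩⟩
    · exact ⟨f, fun h' => absurd h'.2 h⟩
  choose b hb using hb
  refine false_of_allocation_le (p := p) (al := fun n a => allocation S σ
    (fun a => q n (b n) - q n a) (b n) (∑ c ∈ S, (N n c : ℝ) + 1) a) hNV hNn hV hIS hf hfI'
    (fun n => allocation_nonneg hσ _ _ _ (hT0 n)) ?_ hIev hp0 hp1 ?_
  · filter_upwards [hact] with n hn hv
    exact (hb n ⟨hv, hn hv⟩).2
  · filter_upwards [hact, hp] with n hn hpn hv a ha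
    exact hpn (b n) (hb n ⟨hv, hn hv⟩).1 a ha _ (hT0 n)

end AllocationLimit

/-! ### Convergence along a realization -/

section Consistency

variable {X A : Type*} [DecidableEq X] [DecidableEq A] [Fintype X] [MeasurableSpace X]
  [MeasurableSingletonClass X] [Fintype A] {G : Model X A} {P : Params X A} {x₀ : X}

theorem unexpanded_subset (s : Stats X A) (t : ℕ) (x : X) : unexpanded G P s t x ⊆ G.avail x :=
  Finset.filter_subset _ _

theorem ocbaSelect_spec (s : Stats X A) (c : ChoiceRule A) (t : ℕ) (x : X) :
    ∃ b ∈ argmaxOn (G.avail x) (s.Qbar t x), ocbaSelect G P s c t x ∈ argmaxOn (G.avail x) fun a =>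
      allocation (G.avail x) (fun a => (P.sd t x a : ℝ)) (fun a => s.Qbar t x b - s.Qbar t x a) b
        (∑ a ∈ G.avail x, (s.NA t x a : ℝ) + 1) a - s.NA t x a :=
  ⟨_, c.2 _ (argmaxOn_nonempty (G.avail_nonempty x) _),
    c.2 _ (argmaxOn_nonempty (G.avail_nonempty x) _)⟩

theorem act_mem (s : Stats X A) (c : ChoiceRule A) (t : ℕ) (x : X) :
    act G P s c t x ∈ G.avail x := by
  unfold act
  split_ifs with h
  · exact unexpanded_subset s t x (c.2 _ h)
  · obtain ⟨b, -, h⟩ := ocbaSelect_spec (G := G) (P := P) s c t x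
    exact (mem_argmaxOn.1 h).1

theorem act_mem_unexpanded {s : Stats X A} (c : ChoiceRule A) {t : ℕ} {x : X}
    (h : (unexpanded G P s t x).Nonempty) : act G P s c t x ∈ unexpanded G P s t x := by
  rw [act, if_pos h]; exact c.2 _ h

variable {ω : ℕ → ℕ → Noise X A} {t : ℕ} {x : X} {a : A}

theorem NA_run_succ_of_takes (ht : t < G.horizon) {n : ℕ} (h : Takes G P x₀ ω n t x a) :
    (run G P x₀ ω (n + 1)).NA t x a = (run G P x₀ ω n).NA t x a + 1 := by
  have h' := (rollout_of_onPath ht h.1).2.1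
  simp only [h.2] at h'
  rw [run, h', Function.update_self]

theorem NA_Qbar_run_succ_of_not_takes (ht : t < G.horizon) {n : ℕ}
    (h : ¬Takes G P x₀ ω n t x a) :
    (run G P x₀ ω (n + 1)).NA t x a = (run G P x₀ ω n).NA t x a ∧
    (run G P x₀ ω (n + 1)).Qbar t x a = (run G P x₀ ω n).Qbar t x a := by
  by_cases hp : OnPath G P x₀ (run G P x₀ ω n) (ω n) t x
  · have ha : a ≠ act G P (run G P x₀ ω n) (ω n t).2 t x := fun e => h ⟨hp, e.symm⟩
    have h' := rollout_of_onPath ht hp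
    simp only at h'
    rw [run, h'.2.1, h'.2.2.1, Function.update_of_ne ha, Function.update_of_ne ha]
    exact ⟨rfl, rfl⟩
  · have h' := rollout_of_not_onPath ht hp
    simp only at h'
    rw [run, h'.2.1, h'.2.2.1]
    exact ⟨rfl, rfl⟩

theorem Qbar_run_succ_of_takes (ht : t < G.horizon) {n : ℕ} (h : Takes G P x₀ ω n t x a) :
    ((run G P x₀ ω (n + 1)).NA t x a : ℝ) * (run G P x₀ ω (n + 1)).Qbar t x a =
      (run G P x₀ ω n).NA t x a * (run G P x₀ ω n).Qbar t x a +
      (((ω n t).1 x a).1 + (run G P x₀ ω (n + 1)).Vhat (t + 1) ((ω n t).1 x a).2) := by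
  have h' := (rollout_of_onPath ht h.1).2.2.1
  have ho := h.outcome_eq
  simp only [h.2, ho] at h'
  rw [NA_run_succ_of_takes ht h, run, h', Function.update_self]
  push_cast
  field_simp
  ring

theorem monotone_NA_run (ht : t < G.horizon) : Monotone fun n => (run G P x₀ ω n).NA t x a := by
  refine monotone_nat_of_le_succ fun n => ?_
  by_cases h : Takes G P x₀ ω n t x a
  · rw [NA_run_succ_of_takes ht h]; omega
  · rw [(NA_Qbar_run_succ_of_not_takes ht h).1]

theorem tendsto_NA_run (ht : t < G.horizon) (h : ∃ᶠ n in atTop, Takes G P x₀ ω n t x a) :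
    Tendsto (fun n => (run G P x₀ ω n).NA t x a) atTop atTop :=
  tendsto_atTop_of_frequently_lt (monotone_NA_run ht) (h.mono fun n hn => by
    rw [NA_run_succ_of_takes ht hn]; omega)

theorem tendsto_N_run (ht : t < G.horizon)
    (h : ∃ᶠ n in atTop, OnPath G P x₀ (run G P x₀ ω n) (ω n) t x) :
    Tendsto (fun n => (run G P x₀ ω n).N t x) atTop atTop := by
  have hN : ∀ n, OnPath G P x₀ (run G P x₀ ω n) (ω n) t x →
      (run G P x₀ ω (n + 1)).N t x = (run G P x₀ ω n).N t x + 1 := fun n hn =>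
    (rollout_of_onPath ht hn).1
  refine tendsto_atTop_of_frequently_lt (monotone_nat_of_le_succ fun n => ?_) (h.mono fun n hn => by
    rw [hN n hn]; omega)
  by_cases hn : OnPath G P x₀ (run G P x₀ ω n) (ω n) t x
  · rw [hN n hn]; omega
  · exact (rollout_of_not_onPath ht hn).1

/-- An action taken infinitely often eventually has at least `n₀` samples, and the other actions
eventually are not taken. A late visit thus never takes an action with fewer than `n₀` samples, as
an unexpanded node would. -/
theorem eventually_expanded (ht : t < G.horizon) :
    ∀ᶠ n in atTop, OnPath G P x₀ (run G P x₀ ω n) (ω n) t x →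
      ¬(unexpanded G P (run G P x₀ ω n) t x).Nonempty := by
  have h : ∀ᶠ n in atTop, ∀ a : A, Takes G P x₀ ω n t x a →
      P.n₀ ≤ (run G P x₀ ω n).NA t x a := by
    refine eventually_all.2 fun a => ?_
    by_cases hf : ∃ᶠ n in atTop, Takes G P x₀ ω n t x a
    · exact ((tendsto_NA_run ht hf).eventually_ge_atTop P.n₀).mono fun n hn _ => hn
    · exact (not_frequently.1 hf).mono fun n hn h => absurd h hn
  filter_upwards [h] with n hn hp hu
  have h1 := (Finset.mem_filter.1 (act_mem_unexpanded (ω n t).2 hu)).2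
  exact absurd (hn _ ⟨hp, rfl⟩) (not_le.2 h1)

theorem sum_indicator_takes (ht : t < G.horizon) (n : ℕ) :
    ∑ i ∈ Finset.range n, {ω | Takes G P x₀ ω i t x a}.indicator
      (1 : (ℕ → ℕ → Noise X A) → ℝ) ω = (run G P x₀ ω n).NA t x a := by
  induction n with
  | zero => simp [run, Stats.init]
  | succ n ih =>
    rw [Finset.sum_range_succ, ih]
    by_cases h : Takes G P x₀ ω n t x a
    · rw [NA_run_succ_of_takes ht h]; simp [h]
    · rw [(NA_Qbar_run_succ_of_not_takes ht h).1]; simp [h]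

theorem NA_mul_Qbar_run (ht : t < G.horizon) (n : ℕ) :
    ((run G P x₀ ω n).NA t x a : ℝ) * (run G P x₀ ω n).Qbar t x a =
      ∑ i ∈ Finset.range n, {ω | Takes G P x₀ ω i t x a}.indicator
        (1 : (ℕ → ℕ → Noise X A) → ℝ) ω *
        (((ω i t).1 x a).1 + (run G P x₀ ω (i + 1)).Vhat (t + 1) ((ω i t).1 x a).2) := by
  induction n with
  | zero => simp [run, Stats.init]
  | succ n ih =>
    rw [Finset.sum_range_succ, ← ih]
    by_cases h : Takes G P x₀ ω n t x a
    · rw [Qbar_run_succ_of_takes ht h]; simp [h]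
    · rw [(NA_Qbar_run_succ_of_not_takes ht h).1, (NA_Qbar_run_succ_of_not_takes ht h).2]
      simp [h]

theorem Vhat_run_horizon (n : ℕ) (x : X) : (run G P x₀ ω n).Vhat G.horizon x = 0 := by
  induction n generalizing x with
  | zero => rfl
  | succ n ih => exact Vhat_rollout_horizon ih x

/-- The averages of `f` over the outcomes of action `a` at `(t, x)` converge to `l`, if the action is
taken infinitely often. -/
def AveragesTo (G : Model X A) (P : Params X A) (x₀ : X) (ω : ℕ → ℕ → Noise X A) (t : ℕ) (x : X)
    (a : A) (f : ℝ × X → ℝ) (l : ℝ) : Prop :=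
  Tendsto (fun n => ∑ i ∈ Finset.range n,
    {ω | Takes G P x₀ ω i t x a}.indicator (1 : (ℕ → ℕ → Noise X A) → ℝ) ω) atTop atTop →
  Tendsto (fun n => (∑ i ∈ Finset.range n, {ω | Takes G P x₀ ω i t x a}.indicator
    (1 : (ℕ → ℕ → Noise X A) → ℝ) ω * f ((ω i t).1 x a)) / ∑ i ∈ Finset.range n,
    {ω | Takes G P x₀ ω i t x a}.indicator (1 : (ℕ → ℕ → Noise X A) → ℝ) ω) atTop (𝓝 l)

theorem tendsto_sum_indicator_takes (ht : t < G.horizon)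
    (h : ∃ᶠ n in atTop, Takes G P x₀ ω n t x a) :
    Tendsto (fun n => ∑ i ∈ Finset.range n,
      {ω | Takes G P x₀ ω i t x a}.indicator (1 : (ℕ → ℕ → Noise X A) → ℝ) ω) atTop atTop := by
  simp_rw [sum_indicator_takes ht]
  exact tendsto_natCast_atTop_atTop.comp (tendsto_NA_run ht h)

theorem indicator_takes_ne_zero {n : ℕ} :
    {ω | Takes G P x₀ ω n t x a}.indicator (1 : (ℕ → ℕ → Noise X A) → ℝ) ω ≠ 0 ↔
      Takes G P x₀ ω n t x a := by
  simp

/-- Late visits no longer expand, so the path continues through the sampled next node instead of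
ending there. -/
theorem frequently_onPath_succ (ht : t < G.horizon) {y : X}
    (h : ∃ᶠ n in atTop, Takes G P x₀ ω n t x a ∧ ((ω n t).1 x a).2 = y) :
    ∃ᶠ n in atTop, OnPath G P x₀ (run G P x₀ ω n) (ω n) (t + 1) y :=
  (h.and_eventually (eventually_expanded (G := G) (P := P) (x₀ := x₀) (ω := ω) (x := x) ht)).mono
    fun _ ⟨⟨hn, hy⟩, he⟩ => ⟨x, hn.1, he hn.1, by rw [hn.outcome_eq, hy]⟩

/-- Sample means converge if the value estimates of the next nodes do. -/
theorem tendsto_Qbar_run {D : Dynamics X A} (ht : t < G.horizon)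
    (hfreq : ∃ᶠ n in atTop, Takes G P x₀ ω n t x a)
    (hav : AveragesTo G P x₀ ω t x a (cumReward G D t) (Qstar G D t x a))
    (hnext : ∀ y, (∃ᶠ n in atTop, OnPath G P x₀ (run G P x₀ ω n) (ω n) (t + 1) y) →
      Tendsto (fun n => (run G P x₀ ω n).Vhat (t + 1) y) atTop (𝓝 (Vstar G D (t + 1) y))) :
    Tendsto (fun n => (run G P x₀ ω n).Qbar t x a) atTop (𝓝 (Qstar G D t x a)) := by
  set c : ℕ → ℝ := fun i =>
    {ω | Takes G P x₀ ω i t x a}.indicator (1 : (ℕ → ℕ → Noise X A) → ℝ) ω with hc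
  have hK := tendsto_sum_indicator_takes ht hfreq
  have hc0 : ∀ i, 0 ≤ c i := fun i => Set.indicator_nonneg (fun _ _ => zero_le_one) _
  -- The error of replacing `Vhat` by `Vstar`. Next states seen only finitely often do not matter;
  -- the others are visited infinitely often, so their estimates converge.
  have herr := tendsto_weighted_average_zero (c := c)
    (y := fun i => (run G P x₀ ω (i + 1)).Vhat (t + 1) ((ω i t).1 x a).2 -
      Vstar G D (t + 1) ((ω i t).1 x a).2) hc0 hK fun ε hε => by
    have : ∀ᶠ i in atTop, ∀ y : X, Takes G P x₀ ω i t x a → ((ω i t).1 x a).2 = y →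
        |(run G P x₀ ω (i + 1)).Vhat (t + 1) y - Vstar G D (t + 1) y| ≤ ε := by
      refine eventually_all.2 fun y => ?_
      by_cases hy : ∃ᶠ n in atTop, Takes G P x₀ ω n t x a ∧ ((ω n t).1 x a).2 = y
      · have h1 := (hnext y (frequently_onPath_succ ht hy)).comp (tendsto_add_atTop_nat 1)
        have h2 : Tendsto (fun i => (run G P x₀ ω (i + 1)).Vhat (t + 1) y -
            Vstar G D (t + 1) y) atTop (𝓝 0) := by simpa using h1.sub_const (Vstar G D (t + 1) y)
        exact (h2.abs.eventually_le_const (by simpa using hε)).mono fun i hi _ _ => hi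
      · exact (not_frequently.1 hy).mono fun i hi h1 h2 => absurd ⟨h1, h2⟩ hi
    exact this.mono fun i hi hci => hi _ (indicator_takes_ne_zero.1 hci) rfl
  have h := (hav hK).add herr
  rw [add_zero] at h
  refine h.congr' ?_
  filter_upwards [hK.eventually_gt_atTop 0] with n hn
  have hn' : ∑ i ∈ Finset.range n, c i ≠ 0 := ne_of_gt hn
  have hs : ∑ i ∈ Finset.range n, c i = (run G P x₀ ω n).NA t x a := sum_indicator_takes ht n
  rw [← add_div, ← Finset.sum_add_distrib, div_eq_iff hn', hs, mul_comm, NA_mul_Qbar_run ht]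
  exact Finset.sum_congr rfl fun i _ => by simp only [hc, cumReward]; ring

/-- Value estimates converge if the sample means do. -/
theorem tendsto_Vhat_run (ht : t < G.horizon) (hα1 : Tendsto P.α atTop (𝓝 1))
    (hfreq : ∃ᶠ n in atTop, OnPath G P x₀ (run G P x₀ ω n) (ω n) t x) {Q : A → ℝ}
    (hQ : ∀ a ∈ G.avail x, Tendsto (fun n => (run G P x₀ ω n).Qbar t x a) atTop (𝓝 (Q a))) :
    Tendsto (fun n => (run G P x₀ ω n).Vhat t x) atTop
      (𝓝 ((G.avail x).sup' (G.avail_nonempty x) Q)) := by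
  set Vl := (G.avail x).sup' (G.avail_nonempty x) Q
  -- `Vbar` is built from zero by convex combinations with values of `Qbar`, so it inherits this
  -- bound. Only boundedness is needed, since its weight `1 - α` vanishes.
  obtain ⟨B, hB⟩ : ∃ B : ℝ, ∀ a ∈ G.avail x, ∀ n, |(run G P x₀ ω n).Qbar t x a| ≤ B := by
    have : ∀ a, ∃ C : ℝ, a ∈ G.avail x → ∀ n, |(run G P x₀ ω n).Qbar t x a| ≤ C := fun a => by
      by_cases ha : a ∈ G.avail x
      · obtain ⟨C, hC⟩ := (Metric.isBounded_range_of_tendsto _ (hQ a ha)).exists_norm_le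
        exact ⟨C, fun _ n => hC _ ⟨n, rfl⟩⟩
      · exact ⟨0, fun h => absurd h ha⟩
    choose C hC using this
    exact ⟨(G.avail x).sup' (G.avail_nonempty x) C, fun a ha n =>
      (hC a ha n).trans (Finset.le_sup' C ha)⟩
  have hB0 : 0 ≤ B := by
    obtain ⟨a, ha⟩ := G.avail_nonempty x
    exact (abs_nonneg _).trans (hB a ha 0)
  have hVbar : ∀ n, |(run G P x₀ ω n).Vbar t x| ≤ B := fun n => by
    induction n with
    | zero => simpa [run, Stats.init] using hB0
    | succ n ih =>
      by_cases hp : OnPath G P x₀ (run G P x₀ ω n) (ω n) t x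
      · have h := (rollout_of_onPath ht hp).2.2.2.1
        have hq := hB _ (act_mem (G := G) (P := P) (run G P x₀ ω n) (ω n t).2 t x) (n + 1)
        rw [run] at hq ⊢
        rw [h]
        set k : ℕ := (run G P x₀ ω n).N t x
        have e1 : ((k + 1 : ℕ) : ℝ) - 1 = k := by push_cast; ring
        have hk : (0 : ℝ) ≤ (k : ℝ) / (k + 1 : ℕ) := by positivity
        have hk' : (0 : ℝ) ≤ 1 / ((k + 1 : ℕ) : ℝ) := by positivity
        rw [e1]
        refine (abs_add_le _ _).trans ?_
        rw [abs_mul, abs_mul, abs_of_nonneg hk, abs_of_nonneg hk']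
        calc _ ≤ (k : ℝ) / (k + 1 : ℕ) * B + 1 / ((k + 1 : ℕ) : ℝ) * B := by gcongr
          _ = B := by push_cast; field_simp
      · rw [run, (rollout_of_not_onPath ht hp).2.2.2.1]; exact ih
  set g : ℕ → ℝ := fun n => (1 - P.α ((run G P x₀ ω n).N t x)) * (run G P x₀ ω n).Vbar t x +
    P.α ((run G P x₀ ω n).N t x) * (G.avail x).sup' (G.avail_nonempty x) ((run G P x₀ ω n).Qbar t x)
    with hg
  have hgl : Tendsto g atTop (𝓝 Vl) := by
    have hαN := hα1.comp (tendsto_N_run ht hfreq)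
    have h1 : Tendsto (fun n => (1 - P.α ((run G P x₀ ω n).N t x)) *
        (run G P x₀ ω n).Vbar t x) atTop (𝓝 0) := by
      have h0 : Tendsto (fun n => 1 - P.α ((run G P x₀ ω n).N t x)) atTop (𝓝 0) := by
        simpa using hαN.const_sub 1
      exact h0.zero_mul_isBoundedUnder_le ⟨B, eventually_map.2 (Eventually.of_forall hVbar)⟩
    have h2 : Tendsto (fun n => (G.avail x).sup' (G.avail_nonempty x)
        ((run G P x₀ ω n).Qbar t x)) atTop (𝓝 Vl) :=
      Tendsto.finset_sup'_nhds_apply (G.avail_nonempty x) hQ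
    simpa using h1.add (hαN.mul h2)
  -- From some time on the node is no leaf of an expansion, so `Vhat` changes only at visits, where
  -- it becomes `g`. Between visits it stays as close to the limit as at the last one.
  have hnoleaf : ∀ᶠ n in atTop, ∀ u x', t = u + 1 →
      OnPath G P x₀ (run G P x₀ ω n) (ω n) u x' →
        ¬(unexpanded G P (run G P x₀ ω n) u x').Nonempty := by
    rcases t with _ | u
    · exact Eventually.of_forall fun n u x' h => absurd h (by omega)
    · have : ∀ᶠ n in atTop, ∀ x', OnPath G P x₀ (run G P x₀ ω n) (ω n) u x' →
          ¬(unexpanded G P (run G P x₀ ω n) u x').Nonempty :=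
        eventually_all.2 fun x' => eventually_expanded (by omega)
      filter_upwards [this] with n hn u' x' hu'
      obtain rfl : u = u' := by omega
      exact hn x'
  rw [Metric.tendsto_atTop]
  intro ε hε
  obtain ⟨m, hm⟩ := eventually_atTop.1 (hnoleaf.and ((Metric.tendsto_nhds.1 hgl) ε hε))
  obtain ⟨k, hk, hpk⟩ := hfreq.forall_exists_of_atTop m
  have hon : ∀ n ≥ m, OnPath G P x₀ (run G P x₀ ω n) (ω n) t x →
      dist ((run G P x₀ ω (n + 1)).Vhat t x) Vl < ε := fun n hn hp => by
    have h := (rollout_of_onPath ht hp)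
    have h5 := h.2.2.2.2
    rw [← h.1] at h5
    have := (hm (n + 1) (by omega)).2
    rwa [show (run G P x₀ ω (n + 1)).Vhat t x = g (n + 1) from h5]
  refine ⟨k + 1, fun n hn => ?_⟩
  induction n, hn using Nat.le_induction with
  | base => exact hon k hk hpk
  | succ n hn ih =>
    by_cases hp : OnPath G P x₀ (run G P x₀ ω n) (ω n) t x
    · exact hon n (by omega) hp
    · rw [run, (rollout_of_not_onPath ht hp).2.2.2.2 (hm n (by omega)).1]
      exact ih

/-- A node that is visited infinitely often takes all its actions infinitely often. -/
theorem frequently_takes {D : Dynamics X A} (ht : t < G.horizon) (hn₀ : 0 < P.n₀)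
    (hsd : ∀ t x a, 0 < P.sd t x a)
    (hfreq : ∃ᶠ n in atTop, OnPath G P x₀ (run G P x₀ ω n) (ω n) t x)
    (hQ : ∀ a ∈ G.avail x, (∃ᶠ n in atTop, Takes G P x₀ ω n t x a) →
      Tendsto (fun n => (run G P x₀ ω n).Qbar t x a) atTop (𝓝 (Qstar G D t x a)))
    (hne : ∀ a ∈ G.avail x, ∀ b ∈ G.avail x, ∀ n, 0 < (run G P x₀ ω n).NA t x a →
      (run G P x₀ ω n).Qbar t x a ≠ Qstar G D t x b)
    (hdist : 3 ≤ (G.avail x).card → ∀ a ∈ G.avail x, ∀ b ∈ G.avail x, a ≠ b →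
      Qstar G D t x a ≠ Qstar G D t x b) :
    ∀ a ∈ G.avail x, ∃ᶠ n in atTop, Takes G P x₀ ω n t x a := by
  -- The limit of a sample mean: the true mean for a recurring action, the frozen value for any
  -- other.
  have hL : ∀ a, ∃ l : ℝ, ((∃ᶠ n in atTop, Takes G P x₀ ω n t x a) → l = Qstar G D t x a) ∧
      ((¬∃ᶠ n in atTop, Takes G P x₀ ω n t x a) →
        ∀ᶠ n in atTop, (run G P x₀ ω n).Qbar t x a = l) := fun a => by
    by_cases h : ∃ᶠ n in atTop, Takes G P x₀ ω n t x a
    · exact ⟨_, fun _ => rfl, fun h' => absurd h h'⟩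
    · obtain ⟨m, hm⟩ := eventually_atTop.1 (not_frequently.1 h)
      refine ⟨(run G P x₀ ω m).Qbar t x a, fun h' => absurd h' h, fun _ =>
        eventually_atTop.2 ⟨m, fun n hn => ?_⟩⟩
      induction n, hn using Nat.le_induction with
      | base => rfl
      | succ n hn ih => rw [(NA_Qbar_run_succ_of_not_takes ht (hm n hn)).2, ih]
  choose L hL1 hL2 using hL
  have hexp := eventually_expanded (G := G) (P := P) (x₀ := x₀) (ω := ω) (x := x) ht
  refine forall_frequently_of_ocba (S := G.avail x) (σ := fun a => (P.sd t x a : ℝ))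
    (q := fun n => (run G P x₀ ω n).Qbar t x) (N := fun n => (run G P x₀ ω n).NA t x)
    (V := fun n => OnPath G P x₀ (run G P x₀ ω n) (ω n) t x)
    (act := fun n => act G P (run G P x₀ ω n) (ω n t).2 t x) (L := L)
    (fun a => hsd t x a) (fun n hn => (rollout_of_onPath ht hn).2.1)
    (fun n hn => (rollout_of_not_onPath ht hn).2.1) hfreq ?_ ?_ ?_ ?_
  · filter_upwards [hexp] with n hn hp
    rw [act, if_neg (hn hp)]
    exact ocbaSelect_spec _ _ _ _
  · intro a ha hfa
    rw [hL1 a hfa]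
    exact hQ a ha hfa
  · exact fun a _ hfa => hL2 a hfa
  · intro hcard a ha hfa c hc hca
    rw [hL1 a hfa]
    by_cases hfc : ∃ᶠ n in atTop, Takes G P x₀ ω n t x c
    · rw [hL1 c hfc]
      exact hdist hcard a ha c hc hca.symm
    -- At a late visit the node is expanded, so `c` has at least `n₀ > 0` samples, and its frozen
    -- mean then avoids the true mean of `a`.
    · obtain ⟨n, hp, he, hq⟩ := (hfreq.and_eventually (hexp.and (hL2 c hfc))).exists
      rw [← hq]
      refine (hne c hc a ha n ?_).symm
      by_contra h0
      exact he hp ⟨c, Finset.mem_filter.2 ⟨hc, by omega⟩⟩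

/-- Convergence along a realization for which laws of large numbers hold and there are no ties. -/
theorem tendsto_of_frequently_onPath {D : Dynamics X A} (hD : IntegrableRewards G D)
    (hn₀ : 0 < P.n₀) (hsd : ∀ t x a, 0 < P.sd t x a) (hα1 : Tendsto P.α atTop (𝓝 1))
    (hav : ∀ t < G.horizon, ∀ x, ∀ a ∈ G.avail x,
      AveragesTo G P x₀ ω t x a (cumReward G D t) (Qstar G D t x a))
    (hne : ∀ t < G.horizon, ∀ x, ∀ a ∈ G.avail x, ∀ b ∈ G.avail x, ∀ n,
      0 < (run G P x₀ ω n).NA t x a → (run G P x₀ ω n).Qbar t x a ≠ Qstar G D t x b)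
    (hdist : ∀ t < G.horizon, ∀ x, 3 ≤ (G.avail x).card → ∀ a ∈ G.avail x, ∀ b ∈ G.avail x,
      a ≠ b → Qstar G D t x a ≠ Qstar G D t x b) :
    ∀ k t x, t + k = G.horizon →
      (∃ᶠ n in atTop, OnPath G P x₀ (run G P x₀ ω n) (ω n) t x) →
      (t < G.horizon → ∀ a ∈ G.avail x, (∃ᶠ n in atTop, Takes G P x₀ ω n t x a) ∧
        Tendsto (fun n => (run G P x₀ ω n).Qbar t x a) atTop (𝓝 (Qstar G D t x a))) ∧
      Tendsto (fun n => (run G P x₀ ω n).Vhat t x) atTop (𝓝 (Vstar G D t x))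
  | 0, t, x, h, _ => by
    obtain rfl : t = G.horizon := by omega
    refine ⟨fun h => absurd h (lt_irrefl _), ?_⟩
    simp_rw [Vhat_run_horizon, Vstar_horizon hD]
    exact tendsto_const_nhds
  | k + 1, t, x, h, hfreq => by
    have ht : t < G.horizon := by omega
    have hQ : ∀ a ∈ G.avail x, (∃ᶠ n in atTop, Takes G P x₀ ω n t x a) →
        Tendsto (fun n => (run G P x₀ ω n).Qbar t x a) atTop (𝓝 (Qstar G D t x a)) :=
      fun a ha hfa => tendsto_Qbar_run ht hfa (hav t ht x a ha) fun y hy =>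
        (tendsto_of_frequently_onPath hD hn₀ hsd hα1 hav hne hdist k (t + 1) y (by omega) hy).2
    have hall := frequently_takes ht hn₀ hsd hfreq hQ (hne t ht x) (hdist t ht x)
    refine ⟨fun _ a ha => ⟨hall a ha, hQ a ha (hall a ha)⟩, ?_⟩
    rw [Vstar_eq_sup'_Qstar hD ht]
    exact tendsto_Vhat_run ht hα1 hfreq fun a ha => hQ a ha (hall a ha)

theorem Reachable.le_horizon {D : Dynamics X A} (h : Reachable G D x₀ t x) : t ≤ G.horizon := by
  cases h with
  | root => exact Nat.zero_le _
  | step _ ht _ _ => exact ht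

/-- Reachable nodes are visited infinitely often. -/
theorem Reachable.frequently_onPath {D : Dynamics X A}
    (hav : ∀ t < G.horizon, ∀ x, ∀ a ∈ G.avail x, ∀ y,
      AveragesTo G P x₀ ω t x a ((Prod.snd ⁻¹' {y}).indicator 1) (D.trans t x a y))
    (hall : ∀ t < G.horizon, ∀ x, (∃ᶠ n in atTop, OnPath G P x₀ (run G P x₀ ω n) (ω n) t x) →
      ∀ a ∈ G.avail x, ∃ᶠ n in atTop, Takes G P x₀ ω n t x a)
    (h : Reachable G D x₀ t x) :
    ∃ᶠ n in atTop, OnPath G P x₀ (run G P x₀ ω n) (ω n) t x := by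
  induction h with
  | root => exact Eventually.frequently (Eventually.of_forall fun n => rfl)
  | @step t x a y _ ht ha hy ih =>
    have hfa := hall t ht x ih a ha
    have hK := tendsto_sum_indicator_takes ht hfa
    refine frequently_onPath_succ (x := x) (a := a) ht ?_
    -- If `y` followed only finitely often, its empirical frequency would tend to zero, whereas the
    -- law of large numbers gives its positive transition probability.
    by_contra hcon
    have h0 := tendsto_weighted_average_zero
      (y := fun i => (Prod.snd ⁻¹' {y} : Set (ℝ × X)).indicator (1 : ℝ × X → ℝ) ((ω i t).1 x a))
      (fun i => Set.indicator_nonneg (fun _ _ => zero_le_one) _) hK fun ε hε => by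
        filter_upwards [not_frequently.1 hcon] with i hi hci
        have : ((ω i t).1 x a).2 ≠ y := fun e => hi ⟨indicator_takes_ne_zero.1 hci, e⟩
        simpa [this] using hε.le
    exact hy.ne' (tendsto_nhds_unique (hav t ht x a ha y hK) h0)

end Consistency

/-! ### The prior excludes ties -/

section Prior

variable {Θ : Type*} [MeasurableSpace Θ] {ρ : Measure Θ} [IsProbabilityMeasure ρ]

/-- The joint law is a product, and by Fubini the diagonal is null because each of its sections is a
single point. -/
theorem ae_ne_of_indepFun {U W : Θ → ℝ} (hU : AEMeasurable U ρ) (hW : AEMeasurable W ρ)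
    (h : IndepFun U W ρ) [NullSingletonClass (ρ.map U)] : ∀ᵐ θ ∂ρ, U θ ≠ W θ := by
  have hdiag : MeasurableSet {p : ℝ × ℝ | p.1 = p.2} :=
    measurableSet_eq_fun measurable_fst measurable_snd
  have hmap := (indepFun_iff_map_prod_eq_prod_map_map hU hW).1 h
  have := Measure.isProbabilityMeasure_map hU
  have := Measure.isProbabilityMeasure_map hW
  have h0 : (ρ.map fun θ => (U θ, W θ)) {p : ℝ × ℝ | p.1 = p.2} = 0 := by
    rw [hmap, Measure.prod_apply_symm hdiag]
    simp
  rw [Measure.map_apply_of_aemeasurable (hU.prodMk hW) hdiag] at h0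
  rw [ae_iff]
  simpa using h0

/-- The pushforward along a map that is not a.e. measurable is zero by convention, which a
probability law is not. -/
theorem aemeasurable_of_map_eq_gaussianReal {U : Θ → ℝ} {m : ℝ} {v : ℝ≥0}
    (h : ρ.map U = gaussianReal m v) : AEMeasurable U ρ := by
  refine AEMeasurable.of_map_ne_zero ?_
  rw [h]
  exact IsProbabilityMeasure.ne_zero _

theorem ae_eq_of_map_eq_gaussianReal_zero {U : Θ → ℝ} {m : ℝ}
    (h : ρ.map U = gaussianReal m 0) : ∀ᵐ θ ∂ρ, U θ = m := by
  have hU := aemeasurable_of_map_eq_gaussianReal h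
  rw [gaussianReal_zero_var] at h
  have : ∀ᵐ y ∂(ρ.map U), y = m := by rw [h]; simp [ae_dirac_eq]
  exact ae_of_ae_map hU this

/-- Independent normal random variables do not coincide, unless they are the same constant. -/
theorem ae_ne_of_map_eq_gaussianReal {U W : Θ → ℝ} {m m' : ℝ} {τ τ' : ℝ≥0}
    (hU : ρ.map U = gaussianReal m (τ ^ 2)) (hW : ρ.map W = gaussianReal m' (τ' ^ 2))
    (h : IndepFun U W ρ) (hne : τ = 0 → τ' = 0 → m ≠ m') : ∀ᵐ θ ∂ρ, U θ ≠ W θ := by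
  have hUm := aemeasurable_of_map_eq_gaussianReal hU
  have hWm := aemeasurable_of_map_eq_gaussianReal hW
  by_cases hτ : τ = 0
  · by_cases hτ' : τ' = 0
    · rw [hτ, zero_pow two_ne_zero] at hU
      rw [hτ', zero_pow two_ne_zero] at hW
      filter_upwards [ae_eq_of_map_eq_gaussianReal_zero hU, ae_eq_of_map_eq_gaussianReal_zero hW]
        with θ h1 h2
      rw [h1, h2]
      exact hne hτ hτ'
    · have : NullSingletonClass (ρ.map W) := by
        rw [hW]; exact nullSingletonClass_gaussianReal (pow_ne_zero 2 hτ')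
      exact (ae_ne_of_indepFun hWm hUm h.symm).mono fun θ hθ => hθ.symm
  · have : NullSingletonClass (ρ.map U) := by
      rw [hU]; exact nullSingletonClass_gaussianReal (pow_ne_zero 2 hτ)
    exact ae_ne_of_indepFun hUm hWm h

end Prior

/-- Consistency in a fixed environment in which no node with three or more actions has ties. -/
theorem ae_tendsto_of_no_ties {X A : Type*} [Fintype X] [DecidableEq X] [MeasurableSpace X]
    [MeasurableSingletonClass X] [Fintype A] [DecidableEq A] (G : Model X A) (x₀ : X)
    (P : Params X A) (hn₀ : 0 < P.n₀) (hsd : ∀ t x a, 0 < P.sd t x a)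
    (hα1 : Tendsto P.α atTop (𝓝 1)) (ν : Measure (ChoiceRule A)) [IsProbabilityMeasure ν]
    (D : Dynamics X A) (μ : ℕ → X → A → ℝ)
    (hnormal : ∀ t < G.horizon, ∀ x, ∀ a ∈ G.avail x,
      (D.law t x a).map (cumReward G D t) = gaussianReal (μ t x a) (P.sd t x a ^ 2))
    (hdist : ∀ t < G.horizon, ∀ x, 3 ≤ (G.avail x).card → ∀ a ∈ G.avail x, ∀ b ∈ G.avail x,
      a ≠ b → μ t x a ≠ μ t x b) :
    ∀ᵐ ω ∂(runLaw D ν), ∀ t x, Reachable G D x₀ t x →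
      (t < G.horizon → ∀ a ∈ G.avail x,
        ∫ z, cumReward G D t z ∂(D.law t x a) = Qstar G D t x a ∧
        Tendsto (fun N => (run G P x₀ ω N).Qbar t x a) atTop (𝓝 (Qstar G D t x a))) ∧
      Tendsto (fun N => (run G P x₀ ω N).Vhat t x) atTop (𝓝 (Vstar G D t x)) := by
  have hD : IntegrableRewards G D := fun t ht x a ha =>
    integrable_reward_of_map_eq (hnormal t ht x a ha)
  have hμ : ∀ t < G.horizon, ∀ x, ∀ a ∈ G.avail x, μ t x a = Qstar G D t x a :=
    fun t ht x a ha => by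
      rw [← integral_cumReward hD ht ha, integral_cumReward_of_map_eq (hnormal t ht x a ha)]
  have hav : ∀ᵐ ω ∂(runLaw D ν), ∀ t < G.horizon, ∀ x, ∀ a ∈ G.avail x,
      AveragesTo G P x₀ ω t x a (cumReward G D t) (Qstar G D t x a) := by
    refine ae_all_iff.2 fun t => ae_all_iff.2 fun ht => ae_all_iff.2 fun x => ae_all_iff.2 fun a =>
      ae_all_iff.2 fun ha => ?_
    rw [← integral_cumReward hD ht ha]
    exact ae_tendsto_average_outcomes D ν t x a (measurable_cumReward G D t)
      (memLp_cumReward_of_map_eq (hnormal t ht x a ha))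
  have hfrq : ∀ᵐ ω ∂(runLaw D ν), ∀ t < G.horizon, ∀ x, ∀ a ∈ G.avail x, ∀ y,
      AveragesTo G P x₀ ω t x a ((Prod.snd ⁻¹' {y}).indicator 1) (D.trans t x a y) := by
    refine ae_all_iff.2 fun t => ae_all_iff.2 fun ht => ae_all_iff.2 fun x => ae_all_iff.2 fun a =>
      ae_all_iff.2 fun ha => ae_all_iff.2 fun y => ?_
    have hy : MeasurableSet (Prod.snd ⁻¹' {y} : Set (ℝ × X)) :=
      measurable_snd (measurableSet_singleton y)
    have := ae_tendsto_average_outcomes (G := G) (P := P) (x₀ := x₀) D ν t x a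
      (f := (Prod.snd ⁻¹' {y}).indicator 1)
      (measurable_one.indicator hy) ((memLp_const (1 : ℝ)).indicator hy)
    rwa [integral_indicator_one hy] at this
  -- In a fixed environment the true mean of `b` is a constant, so it is a value that the sample
  -- means of `a` almost surely miss.
  have hne : ∀ᵐ ω ∂(runLaw D ν), ∀ t < G.horizon, ∀ x, ∀ a ∈ G.avail x, ∀ b ∈ G.avail x, ∀ n,
      0 < (run G P x₀ ω n).NA t x a → (run G P x₀ ω n).Qbar t x a ≠ Qstar G D t x b := by
    refine ae_all_iff.2 fun t => ae_all_iff.2 fun ht => ae_all_iff.2 fun x => ae_all_iff.2 fun a =>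
      ae_all_iff.2 fun ha => ae_all_iff.2 fun b => ae_all_iff.2 fun hb => ?_
    exact ae_Qbar_ne D ν ht x a (measure_singleton_of_map_eq
      (pow_ne_zero 2 (hsd t x a).ne') (hnormal t ht x a ha)) _
  filter_upwards [hav, hfrq, hne] with ω h1 h2 h3 t x hr
  have key := tendsto_of_frequently_onPath hD hn₀ hsd hα1 h1 h3 fun t ht x hc a ha b hb hab => by
    rw [← hμ t ht x a ha, ← hμ t ht x b hb]
    exact hdist t ht x hc a ha b hb hab
  have hfreq := hr.frequently_onPath h2 fun t ht x hf a ha =>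
    ((key (G.horizon - t) t x (by omega) hf).1 ht a ha).1
  have hle := hr.le_horizon
  have hk := key (G.horizon - t) t x (by omega) hfreq
  exact ⟨fun ht a ha => ⟨integral_cumReward hD ht ha, (hk.1 ht a ha).2⟩, hk.2⟩

end OCBAMCTS

end

theorem theorem1 {X A : Type*} [Fintype X] [DecidableEq X] [MeasurableSpace X]
    [MeasurableSingletonClass X] [Fintype A] [DecidableEq A]
    -- the tree, its root, and the parameters of the algorithm
    (G : OCBAMCTS.Model X A) (x₀ : X) (P : OCBAMCTS.Params X A)
    (hn₀ : 1 < P.n₀) (hsd : ∀ t x a, 0 < P.sd t x a)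
    (hα : ∀ n, P.α n ∈ Set.Icc (0 : ℝ) 1) (hα1 : Tendsto P.α atTop (𝓝 1))
    -- the law of the random choices
    (ν : Measure (OCBAMCTS.ChoiceRule A)) [IsProbabilityMeasure ν]
    -- the unknown environment `θ`, drawn once from the prior `ρ`
    {Θ : Type*} [MeasurableSpace Θ] (ρ : Measure Θ) [IsProbabilityMeasure ρ]
    (D : Θ → OCBAMCTS.Dynamics X A) (μ : Θ → ℕ → X → A → ℝ)
    -- given `θ`, the cumulative reward is normal with mean `μ` and variance `σ²`
    (hnormal : ∀ θ, ∀ t < G.horizon, ∀ x, ∀ a ∈ G.avail x,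
      ((D θ).law t x a).map (OCBAMCTS.cumReward G (D θ) t) =
        gaussianReal (μ θ t x a) (P.sd t x a ^ 2))
    -- the means are normal, and independent for different actions at the same node
    (m : ℕ → X → A → ℝ) (τ : ℕ → X → A → ℝ≥0)
    (hprior : ∀ t < G.horizon, ∀ x, ∀ a ∈ G.avail x,
      ρ.map (fun θ => μ θ t x a) = gaussianReal (m t x a) (τ t x a ^ 2))
    (hindep : ∀ t < G.horizon, ∀ x, ∀ a ∈ G.avail x, ∀ b ∈ G.avail x, a ≠ b →
      IndepFun (fun θ => μ θ t x a) (fun θ => μ θ t x b) ρ)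
    -- prior variances may be zero, if this does not force a tie at a node with three or more actions
    (htie : ∀ t < G.horizon, ∀ x, 3 ≤ (G.avail x).card →
      ∀ a ∈ G.avail x, ∀ b ∈ G.avail x, a ≠ b → τ t x a = 0 → τ t x b = 0 → m t x a ≠ m t x b) :
    ∀ᵐ θ ∂ρ, ∀ᵐ ω ∂(OCBAMCTS.runLaw (D θ) ν),
      ∀ t x, OCBAMCTS.Reachable G (D θ) x₀ t x →
        (t < G.horizon → ∀ a ∈ G.avail x,
          ∫ z, OCBAMCTS.cumReward G (D θ) t z ∂((D θ).law t x a) = OCBAMCTS.Qstar G (D θ) t x a ∧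
          Tendsto (fun N => (OCBAMCTS.run G P x₀ ω N).Qbar t x a) atTop
            (𝓝 (OCBAMCTS.Qstar G (D θ) t x a))) ∧
        Tendsto (fun N => (OCBAMCTS.run G P x₀ ω N).Vhat t x) atTop
          (𝓝 (OCBAMCTS.Vstar G (D θ) t x)) := by
  -- The only use of the prior; the remaining argument holds for each environment without such ties.
  have hties : ∀ᵐ θ ∂ρ, ∀ t < G.horizon, ∀ x, 3 ≤ (G.avail x).card →
      ∀ a ∈ G.avail x, ∀ b ∈ G.avail x, a ≠ b → μ θ t x a ≠ μ θ t x b := by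
    refine ae_all_iff.2 fun t => ae_all_iff.2 fun ht => ae_all_iff.2 fun x => ae_all_iff.2 fun hc =>
      ae_all_iff.2 fun a => ae_all_iff.2 fun ha => ae_all_iff.2 fun b => ae_all_iff.2 fun hb =>
      ae_all_iff.2 fun hab => ?_
    exact OCBAMCTS.ae_ne_of_map_eq_gaussianReal (hprior t ht x a ha) (hprior t ht x b hb)
      (hindep t ht x a ha b hb hab) (htie t ht x hc a ha b hb hab)
  filter_upwards [hties] with θ hθ
  exact OCBAMCTS.ae_tendsto_of_no_ties G x₀ P (by omega) hsd hα1 ν (D θ) (μ θ) (hnormal θ) hθ
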